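/- **Theorem (Uniform subcriticality characterization).** Let $X$ be an infinite set and let $b:X\times X\to[0,\infty)$ be a connected graph over $X$: $b$ is symmetric, vanishes on the diagonal, satisfies $\sum_{y}b(x,y)<\infty$ for every $x\in X$, and any two vertices are joined by a finite path along edges $b>0$. Let $o\in X$ and let $q:X\to\mathbb R$ be a potential such that the form $$h(\varphi,\psi)=\tfrac12\sum_{x,y\in X}b(x,y)(\varphi(x)-\varphi(y))(\psi(x)-\psi(y))+\sum_{x\in X}q(x)\varphi(x)\psi(x),\qquad h(\varphi)=h(\varphi,\varphi),$$ is nonnegative on the space $C_c(X)$ of finitely supported real functions. Notation. "Positive" means $\ge 0$ and $\ne 0$. For $w:X\to\mathbb R$, $h-w\ge0$ means $h(\varphi)\ge\sum_x w(x)\varphi(x)^2$ for all $\varphi\in C_c(X)$. The form $h$ is *subcritical* if $h-w\ge 0$ for some positive $w$; it is *uniformly subcritical* if there is $C>0$ such that for every $x\in X$ there is $w\ge0$ with $w(x)\ge C$ and $h-w\ge0$. The operator $H$ is $Hf(x)=\sum_y b(x,y)(f(x)-f(y))+q(x)f(x)$ on $F(X)=\{f:\sum_y b(x,y)|f(y)|<\infty\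 \text{for all } x\}$, and $u\in F(X)$ is $H$-superharmonic if $Hu\ge0$ on $X$. $H^{(1)}$ is the self-adjoint operator on $\ell^2(X)$ associated with the closure of $h$, and $G(x,y)=\int_0^\infty e^{-tH^{(1)}}1_{\{x\}}(y)\,dt\in[0,\infty]$ is the Green function. Further, $\|\varphi\|_{h,o}=(h(\varphi)+\varphi(o)^2)^{1/2}$, $D_{h,o}$ is the completion of $C_c(X)$ with respect to $\|\cdot\|_{h,o}$, realized as a space of functions on $X$ by pointwise limits, $C_0(X)$ is the closure of $C_c(X)$ with respect to $\|\cdot\|_\infty$, and $\mathrm{cap}_h(\{x\})=\inf\{h(\varphi):\varphi\in C_c(X),\ \varphi(x)=1\}$. Then the following assertions are equivalent: * (i) $h$ is uniformly subcritical. * (i') There is $C>0$ such that $h(\varphi)\ge C\|\varphi\|_\infty^2$ for all $\varphi\in C_c(X)$. * (i'') $h$ is subcritical and there is $C>0$ such that $\|\varphi\|_{h,o}^2\ge C\|\varphi\|_\infty^2$ for all $\varphi\in C_c(X)$. * (ii) There is $C>0$ such that $G(x,x)\le C$ for all $x\in X$. * (iii) There is $C>0$ such that for every $x\in X$ there is a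 positive $H$-superharmonic function $u$ with $u(x)\le C$ and $Hu\ge 1_{\{x\}}$ on $X$. * (iii') There is $C>0$ such that for every $x\in X$ there is a positive $H$-superharmonic function $u$ with $u\le C$ on $X$ and $Hu\ge 1_{\{x\}}$ on $X$. * (iv) $h$ is subcritical and $D_{h,o}\subseteq C_0(X)$. * (v) There is $C>0$ such that $\inf_{x\in X}\mathrm{cap}_h(\{x\})>C$. In particular, if these assertions hold, then $G(x,\cdot)$ is finite and $G(x,\cdot)\in C_0(X)$ for all $x\in X$. -/

import Mathlib

open Filter Topology MeasureTheory
open scoped ENNReal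

noncomputable section

/-- A graph over `X`: a symmetric edge weight `b : X × X → [0,∞)` with zero diagonal which is
locally summable. -/
structure WeightedGraph (X : Type*) where
  weight : X → X → ℝ
  nonneg : ∀ x y, 0 ≤ weight x y
  symm : ∀ x y, weight x y = weight y x
  diag : ∀ x, weight x x = 0
  summable : ∀ x, Summable (weight x)

namespace WeightedGraph

variable {X : Type*}

/-- Any two vertices are joined by a finite path of edges. -/
def Connected (b : WeightedGraph X) : Prop :=
  ∀ x y, Relation.ReflTransGen (fun u v => 0 < b.weight u v) x y

/-! ### The formal operator and the form

The space `C_c(X)` of finitely supported functions is `X →₀ ℝ`. -/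

/-- The domain `F(X)` of the formal Laplacian. -/
def formalDomain (b : WeightedGraph X) : Set (X → ℝ) :=
  {f | ∀ x, Summable fun y => b.weight x y * |f y|}

/-- The formal Schrödinger operator `H = L + q`; it is used on `F(X)` only. -/
def schrodinger (b : WeightedGraph X) (q : X → ℝ) (f : X → ℝ) (x : X) : ℝ :=
  (∑' y, b.weight x y * (f x - f y)) + q x * f x

/-- The bilinear form `h` on `C_c(X) × C_c(X)`. -/
def form (b : WeightedGraph X) (q : X → ℝ) (φ ψ : X →₀ ℝ) : ℝ :=
  (1 / 2) * (∑' p : X × X, b.weight p.1 p.2 * (φ p.1 - φ p.2) * (ψ p.1 - ψ p.2))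
    + ∑' x, q x * φ x * ψ x

/-- `h ≥ 0` on `C_c(X)`. -/
def FormNonneg (b : WeightedGraph X) (q : X → ℝ) : Prop :=
  ∀ φ : X →₀ ℝ, 0 ≤ b.form q φ φ

/-- `h - w ≥ 0` on `C_c(X)`, where `w` also denotes the form `φ ↦ ∑ w φ²`. -/
def FormGe (b : WeightedGraph X) (q w : X → ℝ) : Prop :=
  ∀ φ : X →₀ ℝ, 0 ≤ b.form q φ φ - ∑' x, w x * φ x ^ 2

/-- `h` is subcritical: `h - w ≥ 0` for some positive (nonnegative and nonzero) `w`. -/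
def Subcritical (b : WeightedGraph X) (q : X → ℝ) : Prop :=
  ∃ w : X → ℝ, 0 ≤ w ∧ w ≠ 0 ∧ b.FormGe q w

/-- `h` is uniformly subcritical. -/
def UniformlySubcritical (b : WeightedGraph X) (q : X → ℝ) : Prop :=
  ∃ C : ℝ, 0 < C ∧ ∀ x, ∃ w : X → ℝ, 0 ≤ w ∧ C ≤ w x ∧ b.FormGe q w

/-- `u` is a positive (nonnegative and nonzero) `H`-superharmonic function on `X`. -/
def IsPositiveSuperharmonic (b : WeightedGraph X) (q u : X → ℝ) : Prop :=
  0 ≤ u ∧ u ≠ 0 ∧ u ∈ b.formalDomain ∧ ∀ x, 0 ≤ b.schrodinger q u x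

/-- The capacity of the point `x`. -/
def cap (b : WeightedGraph X) (q : X → ℝ) (x : X) : ℝ :=
  sInf {r | ∃ φ : X →₀ ℝ, φ x = 1 ∧ r = b.form q φ φ}

/-! ### Sup norm, `C_0(X)` and the extended space -/

/-- The sup norm on `C_c(X)`. -/
def supNorm (φ : X →₀ ℝ) : ℝ := ⨆ x, |φ x|

variable (X) in
/-- `C_0(X)`: the closure of `C_c(X)` with respect to uniform convergence. -/
def C0 : Set (X → ℝ) :=
  {f | ∀ ε : ℝ, 0 < ε → ∃ φ : X →₀ ℝ, ∀ x, |f x - φ x| ≤ ε}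

/-- The norm `‖φ‖_{h,o} = (h(φ) + φ(o)²)^{1/2}` on `C_c(X)`. -/
def normAt (b : WeightedGraph X) (q : X → ℝ) (o : X) (φ : X →₀ ℝ) : ℝ :=
  √(b.form q φ φ + φ o ^ 2)

/-- The extended space `D_{h,o}`, the completion of `C_c(X)` with respect to `‖·‖_{h,o}` as a
space of functions: the pointwise limits of the `‖·‖_{h,o}`-Cauchy sequences. -/
def extendedSpace (b : WeightedGraph X) (q : X → ℝ) (o : X) : Set (X → ℝ) :=
  {f | ∃ φ : ℕ → (X →₀ ℝ),
    (∀ ε : ℝ, 0 < ε → ∃ N, ∀ m ≥ N, ∀ n ≥ N, b.normAt q o (φ m - φ n) < ε) ∧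
    ∀ x, Tendsto (fun n => φ n x) atTop (𝓝 (f x))}

/-! ### The self-adjoint operator `H^{(1)}`, its semigroup and the Green function -/

variable (X) in
/-- The real Hilbert space `ℓ²(X)` with respect to the counting measure. -/
abbrev L2 : Type _ := lp (fun _ : X => ℝ) 2

theorem memlp_finsupp (φ : X →₀ ℝ) : Memℓp (E := fun _ : X => ℝ) (fun x => φ x) 2 := by
  refine memℓp_gen (summable_of_hasFiniteSupport (φ.support.finite_toSet.subset ?_))
  intro x hx
  by_contra h
  apply hx
  have h0 : φ x = 0 := by simpa using h
  simp [h0]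

/-- The inclusion `C_c(X) ⊆ ℓ²(X)`. -/
def toL2 (φ : X →₀ ℝ) : L2 X := ⟨fun x => φ x, memlp_finsupp φ⟩

/-- `φ` is a sequence in `C_c(X)` which converges to `f` in `ℓ²(X)` and is Cauchy with respect
to `h` (hence with respect to the form norm `(h(·) + ‖·‖²)^{1/2}`). -/
def IsFormApprox (b : WeightedGraph X) (q : X → ℝ) (φ : ℕ → (X →₀ ℝ)) (f : L2 X) : Prop :=
  (∀ ε : ℝ, 0 < ε → ∃ N, ∀ m ≥ N, ∀ n ≥ N, b.form q (φ m - φ n) (φ m - φ n) < ε) ∧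
    Tendsto (fun n => toL2 (φ n)) atTop (𝓝 f)

/-- The domain `D(h^{(1)})` of the closure of `h` in `ℓ²(X)`. -/
def closureDomain (b : WeightedGraph X) (q : X → ℝ) : Set (L2 X) :=
  {f | ∃ φ, b.IsFormApprox q φ f}

/-- For `f, g ∈ D(h^{(1)})`: the value `h^{(1)}(f, g)` of the closure of `h` is `c`, that is,
`c = lim h(φ_n, ψ_n)` for approximating sequences of `f` and `g`. -/
def ClosureEq (b : WeightedGraph X) (q : X → ℝ) (f g : L2 X) (c : ℝ) : Prop :=
  ∀ φ ψ, b.IsFormApprox q φ f → b.IsFormApprox q ψ g →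
    Tendsto (fun n => b.form q (φ n) (ψ n)) atTop (𝓝 c)

/-- The graph of the self-adjoint operator `H^{(1)}` associated with `h^{(1)}`:
`f ∈ D(H^{(1)})` and `H^{(1)} f = g` if and only if `f ∈ D(h^{(1)})` and
`h^{(1)}(f, ψ) = ⟨g, ψ⟩` for all `ψ ∈ D(h^{(1)})`. -/
def operatorGraph (b : WeightedGraph X) (q : X → ℝ) : Set (L2 X × L2 X) :=
  {p | p.1 ∈ b.closureDomain q ∧
    ∀ ψ ∈ b.closureDomain q, b.ClosureEq q p.1 ψ (inner ℝ p.2 ψ)}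

open Classical in
/-- `(1 + s H^{(1)})⁻¹ f`: the vector `u ∈ D(H^{(1)})` with `u + s H^{(1)} u = f`. -/
def resolventStep (b : WeightedGraph X) (q : X → ℝ) (s : ℝ) (f : L2 X) : L2 X :=
  if hu : ∃ u g : L2 X, (u, g) ∈ b.operatorGraph q ∧ u + s • g = f then hu.choose else 0

/-- The semigroup `e^{-t H^{(1)}}` for `t > 0`, through the exponential formula
`e^{-t H^{(1)}} f = lim_n (1 + (t/n) H^{(1)})^{-n} f` in `ℓ²(X)`. -/
def semigroup (b : WeightedGraph X) (q : X → ℝ) (t : ℝ) (f : L2 X) : L2 X :=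
  limUnder atTop fun n : ℕ => (b.resolventStep q (t / n))^[n] f

/-- The Green function `G(x,y) = ∫_0^∞ e^{-t H^{(1)}} 1_{x} (y) dt`, with the value `∞` where the
integral of this nonnegative function diverges. -/
def green (b : WeightedGraph X) (q : X → ℝ) (x y : X) : ℝ≥0∞ :=
  ∫⁻ t in Set.Ioi (0 : ℝ), ENNReal.ofReal (b.semigroup q t (toL2 (Finsupp.single x 1)) y)

end WeightedGraph

end

/-! Each assertion says in its own language that evaluation at a vertex is bounded for the form,
uniformly in the vertex: C φ(x)² ≤ h(φ) for all φ in C_c(X) and all x. For (i), (i') and (v) this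
only takes a weight w concentrated at x, a point where |φ| is maximal, or a scaling of φ
(`uniformlySubcritical_iff`, `bound_iff_supNorm`, `exists_lt_iInf_cap_iff`).

A positive superharmonic u gives h ≥ Hu/u as a form (`IsPositiveSuperharmonic.sum_le`), so (iii)
implies the bound. Conversely, minimising h(φ) - 2φ(x) produces a bounded u with Hu = 1_x
(`exists_fundamental_solution`), which is (iii').

A local Harnack inequality (`FormNonneg.exists_harnack`) compares values at different vertices; it
carries a subcritical bound to o and turns (i'') into the uniform bound. If (i'') fails, summing
functions of tiny norm and large maximum gives an unbounded element of D_{h,o}, contradicting (iv)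
(`exists_bound_of_extendedSpace_subset`).

For (ii), G(x,x) is the best constant in φ(x)² ≤ C h(φ) (`green_self_le_iff`). The semigroup is a
limit of resolvent powers, so this limit is first shown to exist. Its time integrals are then limits
of s ∑ R_s^{k+1} f, which the operator maps to f - R_s^n f (`IsResolventFamily.sum_mem`), and the
estimate follows by Cauchy-Schwarz. Finally G(x,·) vanishes at infinity: up to a finite time by
square summability, afterwards by Cauchy-Schwarz and the uniform bound on G(y,y) (`green_mem_C0`).
-/

noncomputable section

/-! ### Nonnegative symmetric bilinear forms -/

section Quadratic

variable {V : Type*} [AddCommGroup V] [Module ℝ V] {Q : LinearMap.BilinForm ℝ V}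

theorem bilin_cauchySchwarz (hs : ∀ v w, Q v w = Q w v) (hn : ∀ v, 0 ≤ Q v v) (v w : V) :
    Q v w ^ 2 ≤ Q v v * Q w w := by
  have key : ∀ t : ℝ, 0 ≤ Q w w * (t * t) + (2 * Q v w) * t + Q v v := by
    intro t
    have h := hn (v + t • w)
    simp only [map_add, LinearMap.add_apply, map_smul, LinearMap.smul_apply, smul_eq_mul,
      hs w v] at h
    linarith
  have := discrim_le_zero key
  rw [discrim] at this
  linarith

theorem bilin_add_le (hn : ∀ v, 0 ≤ Q v v) (v w : V) :
    Q (v + w) (v + w) ≤ 2 * Q v v + 2 * Q w w := by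
  have h := hn (v - w)
  simp only [map_add, map_sub, LinearMap.add_apply, LinearMap.sub_apply] at h ⊢
  linarith

theorem bilin_le_two_mul (hn : ∀ v, 0 ≤ Q v v) (v w : V) :
    Q v v ≤ 2 * Q (v - w) (v - w) + 2 * Q w w := by
  simpa using bilin_add_le hn (v - w) w

/-- Together with the next two lemmas this replaces Riesz representation on a completion: the
representer of ℓ is approached by almost minimisers, which stay in V. -/
theorem exists_isGLB_quadratic {ℓ : V →ₗ[ℝ] ℝ} {C : ℝ} (hn : ∀ v, 0 ≤ Q v v)
    (hl : ∀ v, ℓ v ^ 2 ≤ C * Q v v) :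
    ∃ d, (∀ v, d ≤ Q v v - 2 * ℓ v) ∧ ∀ ε > 0, ∃ v, Q v v - 2 * ℓ v < d + ε := by
  have hbdd : BddBelow (Set.range fun v => Q v v - 2 * ℓ v) := by
    refine ⟨-|C|, ?_⟩
    rintro _ ⟨v, rfl⟩
    have h1 : ℓ v ^ 2 ≤ |C| * Q v v :=
      (hl v).trans (mul_le_mul_of_nonneg_right (le_abs_self C) (hn v))
    have h2 : (2 * ℓ v) ^ 2 ≤ (Q v v + |C|) ^ 2 := by
      nlinarith [sq_nonneg (Q v v - |C|)]
    have h3 := abs_le_of_sq_le_sq h2 (add_nonneg (hn v) (abs_nonneg C))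
    simp only
    linarith [(le_abs_self (2 * ℓ v)).trans h3]
  refine ⟨⨅ v, (Q v v - 2 * ℓ v), fun v => ciInf_le hbdd v, fun ε hε => ?_⟩
  exact exists_lt_of_ciInf_lt (lt_add_of_pos_right _ hε)

variable {ℓ : V →ₗ[ℝ] ℝ} {d : ℝ}

/-- Parallelogram law, with d as a lower bound at the midpoint of v and w. Minimising sequences are
therefore Cauchy for Q. -/
theorem bilin_sub_le_of_almost_minimal (hd : ∀ v, d ≤ Q v v - 2 * ℓ v) {ε : ℝ} {v w : V}
    (hv : Q v v - 2 * ℓ v ≤ d + ε) (hw : Q w w - 2 * ℓ w ≤ d + ε) :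
    Q (v - w) (v - w) ≤ 4 * ε := by
  have h := hd ((1 / 2 : ℝ) • (v + w))
  simp only [map_add, map_sub, LinearMap.add_apply, LinearMap.sub_apply, map_smul,
    LinearMap.smul_apply, smul_eq_mul] at h ⊢
  linarith

/-- Approximate Euler-Lagrange equation: the functional along v + t w stays above d, so a quadratic
polynomial in t is nonnegative and its discriminant is not positive. -/
theorem bilin_sq_le_of_almost_minimal (hs : ∀ v w, Q v w = Q w v)
    (hd : ∀ v, d ≤ Q v v - 2 * ℓ v) {ε : ℝ} {v : V} (hv : Q v v - 2 * ℓ v ≤ d + ε) (w : V) :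
    (Q v w - ℓ w) ^ 2 ≤ ε * Q w w := by
  have key : ∀ t : ℝ, 0 ≤ Q w w * (t * t) + (2 * (Q v w - ℓ w)) * t + ε := by
    intro t
    have h := hd (v + t • w)
    simp only [map_add, LinearMap.add_apply, map_smul, LinearMap.smul_apply, smul_eq_mul,
      hs w v] at h
    linarith
  have := discrim_le_zero key
  rw [discrim] at this
  linarith

end Quadratic

/-! ### The form as a bilinear map: Green's formula and passage to the modulus. -/

namespace WeightedGraph

variable {X : Type*} (b : WeightedGraph X) (q : X → ℝ)

/-- The diagonal coefficient `∑_y b(x,y) + q(x)` of the Schrödinger operator. -/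
def diagCoeff (x : X) : ℝ := (∑' y, b.weight x y) + q x

/-- `φ ↦ Hφ(x)` on `C_c(X)`. -/
def opAt (x : X) : (X →₀ ℝ) →ₗ[ℝ] ℝ :=
  b.diagCoeff q x • Finsupp.lapply x - Finsupp.linearCombination ℝ (b.weight x)

theorem opAt_apply (x : X) (φ : X →₀ ℝ) (S : Finset X) (hS : φ.support ⊆ S) :
    b.opAt q x φ = b.diagCoeff q x * φ x - ∑ y ∈ S, b.weight x y * φ y := by
  rw [opAt, LinearMap.sub_apply, Finsupp.linearCombination_apply,
    Finsupp.sum_of_support_subset φ hS _ (by simp)]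
  simp [mul_comm]

/-- The form `h` as a bilinear map. -/
def formBilin : LinearMap.BilinForm ℝ (X →₀ ℝ) := Finsupp.linearCombination ℝ (b.opAt q)

theorem formBilin_apply (φ ψ : X →₀ ℝ) (S : Finset X) (hφ : φ.support ⊆ S) :
    b.formBilin q φ ψ = ∑ x ∈ S, φ x * b.opAt q x ψ := by
  rw [formBilin, Finsupp.linearCombination_apply, Finsupp.sum_of_support_subset φ hφ _ (by simp),
    LinearMap.sum_apply]
  simp

/-- Only the rows with first coordinate in S contribute, and each row converges by local
summability. -/
theorem hasSum_weight_mul_fst (g : X → ℝ) (S : Finset X) (hg : ∀ x ∉ S, g x = 0) :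
    HasSum (fun p : X × X => b.weight p.1 p.2 * g p.1)
      (∑ x ∈ S, (∑' y, b.weight x y) * g x) := by
  classical
  have h1 : ∀ x ∈ S, HasSum (fun p : X × X => if p.1 = x then b.weight p.1 p.2 * g p.1 else 0)
      ((∑' y, b.weight x y) * g x) := by
    intro x _
    have hinj : Function.Injective (fun y : X => (x, y)) := fun y z h => (Prod.mk.inj h).2
    refine (hinj.hasSum_iff ?_).1 ?_
    · rintro ⟨p, r⟩ hp
      rw [if_neg]
      rintro rfl
      exact hp ⟨r, rfl⟩
    · simpa [Function.comp_def] using (b.summable x).hasSum.mul_right (g x)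
  refine (hasSum_sum h1).congr_fun ?_
  intro p
  by_cases hp : p.1 ∈ S
  · rw [Finset.sum_ite_eq S p.1, if_pos hp]
  · rw [Finset.sum_ite_eq S p.1, if_neg hp, hg _ hp, mul_zero]

/-- Green's formula. The product of differences is expanded into four families: the two diagonal
ones converge by local summability, the two mixed ones have finite support. -/
theorem form_eq_formBilin (φ ψ : X →₀ ℝ) : b.form q φ ψ = b.formBilin q φ ψ := by
  classical
  set S := φ.support ∪ ψ.support with hS
  have hφ : ∀ x ∉ S, φ x = 0 := fun x hx => by
    rw [hS, Finset.mem_union, not_or] at hx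
    simpa using hx.1
  have hψ : ∀ x ∉ S, ψ x = 0 := fun x hx => by
    rw [hS, Finset.mem_union, not_or] at hx
    simpa using hx.2
  have h1 := b.hasSum_weight_mul_fst (fun x => φ x * ψ x) S (fun x hx => by simp [hφ x hx])
  have h2 : HasSum (fun p : X × X => b.weight p.1 p.2 * (φ p.2 * ψ p.2))
      (∑ x ∈ S, (∑' y, b.weight x y) * (φ x * ψ x)) := by
    have := (Equiv.prodComm X X).hasSum_iff.2 h1
    refine this.congr_fun fun p => ?_
    simp [b.symm p.1 p.2]
  have h3 : HasSum (fun p : X × X => b.weight p.1 p.2 * (φ p.1 * ψ p.2))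
      (∑ x ∈ S, ∑ y ∈ S, b.weight x y * (φ x * ψ y)) := by
    rw [← Finset.sum_product']
    refine hasSum_sum_of_ne_finset_zero fun p hp => ?_
    rw [Finset.mem_product, not_and_or] at hp
    rcases hp with hp | hp
    · simp [hφ _ hp]
    · simp [hψ _ hp]
  have h4 : HasSum (fun p : X × X => b.weight p.1 p.2 * (φ p.2 * ψ p.1))
      (∑ x ∈ S, ∑ y ∈ S, b.weight x y * (φ x * ψ y)) := by
    have := (Equiv.prodComm X X).hasSum_iff.2 h3
    refine this.congr_fun fun p => ?_
    simp [b.symm p.1 p.2]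
  have h5 : HasSum (fun p : X × X => b.weight p.1 p.2 * (φ p.1 - φ p.2) * (ψ p.1 - ψ p.2)) _ :=
    (((h1.add h2).sub h3).sub h4).congr_fun fun p => by ring
  have h6 : HasSum (fun x => q x * φ x * ψ x) (∑ x ∈ S, q x * φ x * ψ x) :=
    hasSum_sum_of_ne_finset_zero fun x hx => by simp [hφ x hx]
  rw [form, h5.tsum_eq, h6.tsum_eq, b.formBilin_apply q φ ψ S Finset.subset_union_left]
  have h7 : ∑ x ∈ S, φ x * b.opAt q x ψ = ∑ x ∈ S, (∑' y, b.weight x y) * (φ x * ψ x)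
      + ∑ x ∈ S, q x * φ x * ψ x - ∑ x ∈ S, ∑ y ∈ S, b.weight x y * (φ x * ψ y) := by
    rw [← Finset.sum_add_distrib, ← Finset.sum_sub_distrib]
    refine Finset.sum_congr rfl fun x _ => ?_
    rw [b.opAt_apply q x ψ S Finset.subset_union_right, diagCoeff, mul_sub, Finset.mul_sum]
    congr 1
    · ring
    · exact Finset.sum_congr rfl fun y _ => by ring
  rw [h7]
  ring

theorem formBilin_eq_sum (φ ψ : X →₀ ℝ) (S : Finset X) (hφ : φ.support ⊆ S)
    (hψ : ψ.support ⊆ S) :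
    b.formBilin q φ ψ = ∑ x ∈ S, b.diagCoeff q x * (φ x * ψ x)
      - ∑ x ∈ S, ∑ y ∈ S, b.weight x y * (φ x * ψ y) := by
  rw [b.formBilin_apply q φ ψ S hφ, ← Finset.sum_sub_distrib]
  refine Finset.sum_congr rfl fun x _ => ?_
  rw [b.opAt_apply q x ψ S hψ, mul_sub, Finset.mul_sum]
  congr 1
  · ring
  · exact Finset.sum_congr rfl fun y _ => by ring

theorem formBilin_comm (φ ψ : X →₀ ℝ) : b.formBilin q φ ψ = b.formBilin q ψ φ := by
  rw [← form_eq_formBilin, ← form_eq_formBilin, form, form]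
  congr 2
  · exact tsum_congr fun p => by ring
  · funext x
    ring

@[simp]
theorem formBilin_single_left (x : X) (ψ : X →₀ ℝ) :
    b.formBilin q (Finsupp.single x 1) ψ = b.opAt q x ψ := by
  simp [formBilin]

theorem opAt_single_self (x : X) : b.opAt q x (Finsupp.single x 1) = b.diagCoeff q x := by
  simp [opAt, b.diag]

/-- The modulus of a finitely supported function. -/
def absFinsupp (φ : X →₀ ℝ) : X →₀ ℝ := φ.mapRange (fun t => |t|) abs_zero

@[simp]
theorem absFinsupp_apply (φ : X →₀ ℝ) (x : X) : absFinsupp φ x = |φ x| := rfl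

/-- The off-diagonal coefficients -b(x,y) are not positive and the diagonal terms see only φ². -/
theorem formBilin_abs_le (φ : X →₀ ℝ) :
    b.formBilin q (absFinsupp φ) (absFinsupp φ) ≤ b.formBilin q φ φ := by
  have hS : (absFinsupp φ).support ⊆ φ.support := Finsupp.support_mapRange
  rw [b.formBilin_eq_sum q _ _ φ.support hS hS,
    b.formBilin_eq_sum q _ _ φ.support subset_rfl subset_rfl]
  simp only [absFinsupp_apply, abs_mul_abs_self]
  refine sub_le_sub_left (Finset.sum_le_sum fun x _ => Finset.sum_le_sum fun y _ => ?_) _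
  rw [← abs_mul]
  exact mul_le_mul_of_nonneg_left (le_abs_self _) (b.nonneg x y)

variable {b q}

theorem FormNonneg.bilin (hq : b.FormNonneg q) (φ : X →₀ ℝ) : 0 ≤ b.formBilin q φ φ := by
  rw [← form_eq_formBilin]
  exact hq φ

theorem FormNonneg.cauchySchwarz (hq : b.FormNonneg q) (φ ψ : X →₀ ℝ) :
    b.formBilin q φ ψ ^ 2 ≤ b.formBilin q φ φ * b.formBilin q ψ ψ :=
  bilin_cauchySchwarz (b.formBilin_comm q) hq.bilin φ ψ

theorem abs_le_supNorm (φ : X →₀ ℝ) (x : X) : |φ x| ≤ supNorm φ := by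
  refine le_ciSup (f := fun x => |φ x|) ?_ x
  have : (Set.range fun x => |φ x|) ⊆ ((fun t => |t|) '' (Set.range φ)) := by
    rintro _ ⟨x, rfl⟩
    exact ⟨_, ⟨x, rfl⟩, rfl⟩
  exact ((φ.finite_range.image _).subset this).bddAbove

theorem supNorm_eq_abs [Nonempty X] (φ : X →₀ ℝ) : ∃ x, supNorm φ = |φ x| := by
  have hfin : (Set.range fun x => |φ x|).Finite := by
    have : (Set.range fun x => |φ x|) ⊆ ((fun t => |t|) '' (Set.range φ)) := by
      rintro _ ⟨x, rfl⟩
      exact ⟨_, ⟨x, rfl⟩, rfl⟩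
    exact (φ.finite_range.image _).subset this
  obtain ⟨x, hx⟩ := (Set.range_nonempty fun x => |φ x|).csSup_mem hfin
  exact ⟨x, hx.symm⟩

end WeightedGraph

namespace WeightedGraph

variable {X : Type*} {b : WeightedGraph X} {q : X → ℝ}

/-! ### Pointwise bounds of the form -/

theorem tsum_mul_sq_eq_sum (w : X → ℝ) (φ : X →₀ ℝ) :
    ∑' x, w x * φ x ^ 2 = ∑ x ∈ φ.support, w x * φ x ^ 2 :=
  tsum_eq_sum fun x hx => by simp [Finsupp.notMem_support_iff.1 hx]

theorem FormGe.mul_sq_le {w : X → ℝ} (hw : 0 ≤ w) (h : b.FormGe q w) (φ : X →₀ ℝ) (x : X) :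
    w x * φ x ^ 2 ≤ b.formBilin q φ φ := by
  have h1 := h φ
  rw [tsum_mul_sq_eq_sum, form_eq_formBilin, sub_nonneg] at h1
  refine le_trans ?_ h1
  by_cases hx : x ∈ φ.support
  · exact Finset.single_le_sum (f := fun x => w x * φ x ^ 2)
      (fun y _ => mul_nonneg (hw y) (sq_nonneg _)) hx
  · rw [Finsupp.notMem_support_iff.1 hx]
    simpa using Finset.sum_nonneg fun y _ => mul_nonneg (hw y) (sq_nonneg (φ y))

theorem formGe_single {c : ℝ} {x : X} (h : ∀ φ : X →₀ ℝ, c * φ x ^ 2 ≤ b.formBilin q φ φ) :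
    b.FormGe q (Finsupp.single x c) := by
  intro φ
  rw [form_eq_formBilin, sub_nonneg, tsum_eq_single x fun y hy => by
    rw [Finsupp.single_eq_of_ne hy, zero_mul], Finsupp.single_eq_same]
  exact h φ

/-- The right-hand side is the hub through which the equivalences pass. Discarding all of w except
its value at x loses nothing, since the constant concerns that value only. -/
theorem uniformlySubcritical_iff :
    b.UniformlySubcritical q ↔
      ∃ C : ℝ, 0 < C ∧ ∀ (φ : X →₀ ℝ) (x : X), C * φ x ^ 2 ≤ b.formBilin q φ φ := by
  constructor
  · rintro ⟨C, hC, h⟩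
    refine ⟨C, hC, fun φ x => ?_⟩
    obtain ⟨w, hw, hCw, hge⟩ := h x
    exact (mul_le_mul_of_nonneg_right hCw (sq_nonneg _)).trans (hge.mul_sq_le hw φ x)
  · rintro ⟨C, hC, h⟩
    refine ⟨C, hC, fun x => ⟨Finsupp.single x C, ?_, by simp, formGe_single fun φ => h φ x⟩⟩
    exact Finsupp.single_nonneg.2 hC.le

theorem Subcritical.exists_bound (h : b.Subcritical q) :
    ∃ (x : X) (c : ℝ), 0 < c ∧ ∀ φ : X →₀ ℝ, c * φ x ^ 2 ≤ b.formBilin q φ φ := by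
  obtain ⟨w, hw, hw0, hge⟩ := h
  obtain ⟨x, hx⟩ := Function.ne_iff.1 hw0
  exact ⟨x, w x, lt_of_le_of_ne (hw x) (Ne.symm hx), fun φ => hge.mul_sq_le hw φ x⟩

theorem subcritical_of_bound {x : X} {c : ℝ} (hc : 0 < c)
    (h : ∀ φ : X →₀ ℝ, c * φ x ^ 2 ≤ b.formBilin q φ φ) : b.Subcritical q := by
  refine ⟨Finsupp.single x c, Finsupp.single_nonneg.2 hc.le, fun h0 => ?_, formGe_single h⟩
  have := congrFun h0 x
  simp at this
  exact hc.ne' this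

theorem bound_iff_supNorm [Nonempty X] {C : ℝ} {F : (X →₀ ℝ) → ℝ} :
    (∀ φ, C * supNorm φ ^ 2 ≤ F φ) ∧ 0 ≤ C ↔
      (∀ φ x, C * φ x ^ 2 ≤ F φ) ∧ 0 ≤ C := by
  refine and_congr_left fun hC => ⟨fun h φ x => le_trans ?_ (h φ), fun h φ => ?_⟩
  · rw [← sq_abs (φ x)]
    gcongr
    exact abs_le_supNorm φ x
  · obtain ⟨x, hx⟩ := supNorm_eq_abs φ
    rw [hx, sq_abs]
    exact h φ x

theorem FormNonneg.normAt_sq (hq : b.FormNonneg q) (o : X) (φ : X →₀ ℝ) :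
    b.normAt q o φ ^ 2 = b.formBilin q φ φ + φ o ^ 2 := by
  rw [normAt, form_eq_formBilin, Real.sq_sqrt (add_nonneg (hq.bilin φ) (sq_nonneg _))]

/-! ### The local Harnack inequality -/

theorem FormNonneg.diagCoeff_nonneg (hq : b.FormNonneg q) (x : X) : 0 ≤ b.diagCoeff q x := by
  simpa [opAt_single_self] using hq.bilin (Finsupp.single x 1)

theorem FormNonneg.opAt_sq_le (hq : b.FormNonneg q) (x : X) (φ : X →₀ ℝ) :
    b.opAt q x φ ^ 2 ≤ b.diagCoeff q x * b.formBilin q φ φ := by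
  simpa [opAt_single_self] using hq.cauchySchwarz (Finsupp.single x 1) φ

/-- One term of the nonnegative sum ∑ b(x,z)|φ(z)| is at most the whole sum, which equals the
diagonal coefficient times |φ(x)| minus H|φ|(x). Cauchy-Schwarz against 1_x controls H|φ|(x) by the
form of |φ|, hence by that of φ. -/
theorem FormNonneg.weight_mul_sq_le (hq : b.FormNonneg q) (x y : X) (φ : X →₀ ℝ) :
    b.weight x y ^ 2 * φ y ^ 2 ≤
      2 * (b.diagCoeff q x ^ 2 * φ x ^ 2 + b.diagCoeff q x * b.formBilin q φ φ) := by
  classical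
  have h1 := hq.opAt_sq_le x (absFinsupp φ)
  have h2 := b.opAt_apply q x (absFinsupp φ) (insert y (absFinsupp φ).support)
    (Finset.subset_insert _ _)
  have h3 : b.weight x y * |φ y| ≤ b.diagCoeff q x * |φ x| - b.opAt q x (absFinsupp φ) := by
    rw [h2, absFinsupp_apply φ x, sub_sub_cancel]
    exact Finset.single_le_sum (f := fun y => b.weight x y * (absFinsupp φ) y)
      (fun z _ => mul_nonneg (b.nonneg x z) (abs_nonneg _)) (Finset.mem_insert_self _ _)
  have h4 : (b.weight x y * |φ y|) ^ 2 ≤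
      (b.diagCoeff q x * |φ x| - b.opAt q x (absFinsupp φ)) ^ 2 :=
    pow_le_pow_left₀ (mul_nonneg (b.nonneg x y) (abs_nonneg _)) h3 2
  have h5 := mul_le_mul_of_nonneg_left (b.formBilin_abs_le q φ) (hq.diagCoeff_nonneg x)
  have h6 := sq_nonneg (b.diagCoeff q x * |φ x| + b.opAt q x (absFinsupp φ))
  rw [mul_pow, sq_abs] at h4
  nlinarith [sq_abs (φ x)]

/-- Induction along a path, using the one-edge estimate at each step. -/
theorem FormNonneg.exists_harnack (hq : b.FormNonneg q) (hb : b.Connected) (x y : X) :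
    ∃ C : ℝ, 0 < C ∧ ∀ φ : X →₀ ℝ, φ y ^ 2 ≤ C * (b.formBilin q φ φ + φ x ^ 2) := by
  have h := hb x y
  induction h with
  | refl => exact ⟨1, one_pos, fun φ => by linarith [hq.bilin φ]⟩
  | @tail y z _ hyz ih =>
    obtain ⟨C, hC, h⟩ := ih
    set K := b.diagCoeff q y with hK
    have hK0 : 0 ≤ K := hq.diagCoeff_nonneg y
    set w := b.weight y z with hw
    -- The edge estimate and the induction hypothesis need only K² C + K; the added 1 makes the
    -- constant visibly positive.
    refine ⟨2 * (K ^ 2 * C + K + 1) / w ^ 2, by positivity, fun φ => ?_⟩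
    have h1 := hq.weight_mul_sq_le y z φ
    rw [div_mul_eq_mul_div, le_div_iff₀ (by positivity), mul_comm]
    refine h1.trans ?_
    have h2 := mul_le_mul_of_nonneg_left (h φ) (sq_nonneg K)
    have h3 := mul_nonneg hK0 (sq_nonneg (φ x))
    nlinarith [hq.bilin φ, sq_nonneg (φ x)]

theorem Subcritical.exists_bound_at (h : b.Subcritical q) (hq : b.FormNonneg q)
    (hb : b.Connected) (y : X) :
    ∃ c : ℝ, 0 < c ∧ ∀ φ : X →₀ ℝ, c * φ y ^ 2 ≤ b.formBilin q φ φ := by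
  obtain ⟨x, c, hc, hx⟩ := h.exists_bound
  obtain ⟨C, hC, hy⟩ := hq.exists_harnack hb x y
  refine ⟨c / (C * (c + 1)), by positivity, fun φ => ?_⟩
  rw [div_mul_eq_mul_div, div_le_iff₀ (by positivity)]
  have h1 := mul_le_mul_of_nonneg_left (hy φ) hc.le
  have h2 := mul_le_mul_of_nonneg_left (hx φ) hC.le
  linarith

theorem FormNonneg.exists_bound_normAt (hq : b.FormNonneg q) (hb : b.Connected) (o x : X) :
    ∃ C : ℝ, 0 < C ∧ ∀ φ : X →₀ ℝ, |φ x| ≤ C * b.normAt q o φ := by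
  obtain ⟨C, hC, h⟩ := hq.exists_harnack hb o x
  refine ⟨√C, Real.sqrt_pos.2 hC, fun φ => ?_⟩
  refine abs_le_of_sq_le_sq ?_ (mul_nonneg (Real.sqrt_nonneg _) (Real.sqrt_nonneg _))
  rw [mul_pow, Real.sq_sqrt hC.le, hq.normAt_sq]
  exact h φ

/-! ### Capacity -/

theorem FormNonneg.le_cap_iff (hq : b.FormNonneg q) {c : ℝ} {x : X} :
    c ≤ b.cap q x ↔ ∀ φ : X →₀ ℝ, c * φ x ^ 2 ≤ b.formBilin q φ φ := by
  have hbdd : BddBelow {r | ∃ φ : X →₀ ℝ, φ x = 1 ∧ r = b.form q φ φ} :=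
    ⟨0, by rintro _ ⟨φ, -, rfl⟩; exact hq φ⟩
  rw [cap, le_csInf_iff hbdd ⟨_, Finsupp.single x 1, by simp, rfl⟩]
  constructor
  · intro h φ
    by_cases hx : φ x = 0
    · simpa [hx] using hq.bilin φ
    · have h1 := h _ ⟨(φ x)⁻¹ • φ, by simp [hx], rfl⟩
      rw [form_eq_formBilin] at h1
      simp only [map_smul, LinearMap.smul_apply, smul_eq_mul] at h1
      have h2 : 0 < φ x ^ 2 := by positivity
      calc c * φ x ^ 2 ≤ (φ x)⁻¹ * ((φ x)⁻¹ * b.formBilin q φ φ) * φ x ^ 2 :=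
            mul_le_mul_of_nonneg_right h1 h2.le
        _ = b.formBilin q φ φ := by field_simp
  · rintro h _ ⟨φ, hφ, rfl⟩
    simpa [hφ, form_eq_formBilin] using h φ

theorem FormNonneg.exists_lt_iInf_cap_iff [Nonempty X] (hq : b.FormNonneg q) :
    (∃ C : ℝ, 0 < C ∧ C < ⨅ x, b.cap q x) ↔
      ∃ C : ℝ, 0 < C ∧ ∀ (φ : X →₀ ℝ) (x : X), C * φ x ^ 2 ≤ b.formBilin q φ φ := by
  have hbdd : BddBelow (Set.range (b.cap q)) := by
    refine ⟨0, ?_⟩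
    rintro _ ⟨x, rfl⟩
    exact hq.le_cap_iff.2 fun φ => by simpa using hq.bilin φ
  constructor
  · rintro ⟨C, hC, h⟩
    exact ⟨C, hC, fun φ x => hq.le_cap_iff.1 (h.le.trans (ciInf_le hbdd x)) φ⟩
  · rintro ⟨C, hC, h⟩
    -- The bound is halved because assertion (v) asks for a strict inequality.
    refine ⟨C / 2, half_pos hC, (half_lt_self hC).trans_le (le_ciInf fun x => ?_)⟩
    exact hq.le_cap_iff.2 fun φ => h φ x

/-! ### Superharmonic functions -/

theorem schrodinger_eq {u : X → ℝ} (hu : u ∈ b.formalDomain) (x : X) :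
    Summable (fun y => b.weight x y * u y) ∧
      b.schrodinger q u x = b.diagCoeff q x * u x - ∑' y, b.weight x y * u y := by
  have h1 : Summable (fun y => b.weight x y * u y) := by
    refine Summable.of_norm ?_
    simpa [abs_mul, abs_of_nonneg (b.nonneg x _)] using hu x
  refine ⟨h1, ?_⟩
  rw [schrodinger, diagCoeff]
  simp only [mul_sub]
  rw [((b.summable x).mul_right (u x)).tsum_sub h1, tsum_mul_right]
  ring

/-- Minimum principle: at a zero of u the value Hu is -∑ b u, which is negative if some neighbour
carries a positive value. Positivity thus spreads along paths. -/
theorem IsPositiveSuperharmonic.pos (hb : b.Connected) {u : X → ℝ}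
    (hu : b.IsPositiveSuperharmonic q u) (x : X) : 0 < u x := by
  obtain ⟨h0, hne, hd, hs⟩ := hu
  obtain ⟨z, hz⟩ := Function.ne_iff.1 hne
  have hz' : 0 < u z := lt_of_le_of_ne (h0 z) (Ne.symm hz)
  have h := hb z x
  induction h with
  | refl => exact hz'
  | @tail x y _ hxy ih =>
    refine lt_of_le_of_ne (h0 y) fun hy => ?_
    obtain ⟨h1, h2⟩ := schrodinger_eq (q := q) hd y
    have h3 := hs y
    rw [h2, ← hy] at h3
    have h4 := h1.le_tsum x fun z _ => mul_nonneg (b.nonneg y z) (h0 z)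
    have h5 : 0 < b.weight y x * u x := mul_pos (b.symm x y ▸ hxy) ih
    simp only [mul_zero, zero_sub] at h3
    linarith

/-- Agmon-Allegretto-Piepenbrink argument: 2φ(x)φ(y) ≤ (u(y)/u(x)) φ(x)² + (u(x)/u(y)) φ(y)², summed
against the symmetric weight b. The terms b(x,y)u(y) with y outside the support of φ have a
favourable sign and are dropped. -/
theorem IsPositiveSuperharmonic.sum_le (hb : b.Connected) {u : X → ℝ}
    (hu : b.IsPositiveSuperharmonic q u) (φ : X →₀ ℝ) :
    ∑ x ∈ φ.support, b.schrodinger q u x / u x * φ x ^ 2 ≤ b.formBilin q φ φ := by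
  have hpos := hu.pos hb
  obtain ⟨h0, -, hd, -⟩ := hu
  set S := φ.support
  rw [b.formBilin_eq_sum q φ φ S subset_rfl subset_rfl]
  have h1 : ∀ x ∈ S, b.schrodinger q u x / u x * φ x ^ 2 ≤ b.diagCoeff q x * (φ x * φ x) -
      ∑ y ∈ S, b.weight x y * (u y / u x * φ x ^ 2) := by
    intro x _
    obtain ⟨hs, he⟩ := schrodinger_eq (q := q) hd x
    have h2 := hs.sum_le_tsum S fun y _ => mul_nonneg (b.nonneg x y) (h0 y)
    have h3 : ∑ y ∈ S, b.weight x y * (u y / u x * φ x ^ 2)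
        = (∑ y ∈ S, b.weight x y * u y) / u x * φ x ^ 2 := by
      rw [Finset.sum_div, Finset.sum_mul]
      exact Finset.sum_congr rfl fun y _ => by ring
    have h4 : (∑ y ∈ S, b.weight x y * u y) / u x * φ x ^ 2 ≤
        (∑' y, b.weight x y * u y) / u x * φ x ^ 2 :=
      mul_le_mul_of_nonneg_right (div_le_div_of_nonneg_right h2 (h0 x)) (sq_nonneg _)
    have h5 : b.schrodinger q u x / u x * φ x ^ 2 = b.diagCoeff q x * (φ x * φ x)
        - (∑' y, b.weight x y * u y) / u x * φ x ^ 2 := by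
      rw [he]
      field_simp [(hpos x).ne']
    rw [h5, h3]
    linarith
  refine (Finset.sum_le_sum h1).trans ?_
  rw [Finset.sum_sub_distrib]
  refine sub_le_sub_left ?_ _
  have h6 : ∑ x ∈ S, ∑ y ∈ S, b.weight x y * (u y / u x * φ x ^ 2)
      = ∑ x ∈ S, ∑ y ∈ S, b.weight x y * (u x / u y * φ y ^ 2) := by
    rw [Finset.sum_comm]
    exact Finset.sum_congr rfl fun x _ => Finset.sum_congr rfl fun y _ => by rw [b.symm]
  have h7 : 2 * ∑ x ∈ S, ∑ y ∈ S, b.weight x y * (φ x * φ y) ≤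
      ∑ x ∈ S, ∑ y ∈ S, b.weight x y * (u y / u x * φ x ^ 2)
      + ∑ x ∈ S, ∑ y ∈ S, b.weight x y * (u x / u y * φ y ^ 2) := by
    rw [Finset.mul_sum, ← Finset.sum_add_distrib]
    refine Finset.sum_le_sum fun x _ => ?_
    rw [Finset.mul_sum, ← Finset.sum_add_distrib]
    refine Finset.sum_le_sum fun y _ => ?_
    have hx := hpos x
    have hy := hpos y
    have h8 : 0 ≤ u y / u x * φ x ^ 2 + u x / u y * φ y ^ 2 - 2 * (φ x * φ y) := by
      have : u y / u x * φ x ^ 2 + u x / u y * φ y ^ 2 - 2 * (φ x * φ y)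
          = (u y * φ x - u x * φ y) ^ 2 / (u x * u y) := by
        field_simp
        ring
      rw [this]
      positivity
    nlinarith [mul_nonneg (b.nonneg x y) h8]
  linarith

theorem IsPositiveSuperharmonic.mul_sq_le (hb : b.Connected) {u : X → ℝ}
    (hu : b.IsPositiveSuperharmonic q u) {C : ℝ} {x : X} (hux : u x ≤ C)
    (h : 1 ≤ b.schrodinger q u x) (φ : X →₀ ℝ) : C⁻¹ * φ x ^ 2 ≤ b.formBilin q φ φ := by
  refine le_trans ?_ (hu.sum_le hb φ)
  have hpos := hu.pos hb
  have h0 : ∀ y ∈ φ.support, 0 ≤ b.schrodinger q u y / u y * φ y ^ 2 := fun y _ =>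
    mul_nonneg (div_nonneg (hu.2.2.2 y) (hpos y).le) (sq_nonneg _)
  by_cases hx : x ∈ φ.support
  · refine le_trans ?_ (Finset.single_le_sum h0 hx)
    refine mul_le_mul_of_nonneg_right ?_ (sq_nonneg _)
    rw [inv_eq_one_div]
    exact div_le_div₀ (zero_le_one.trans h) h (hpos x) hux
  · rw [Finsupp.notMem_support_iff.1 hx]
    simpa using Finset.sum_nonneg h0

end WeightedGraph

/-! ### The triangle inequality for the seminorm of a nonnegative form. -/

section Quadratic

variable {V : Type*} [AddCommGroup V] [Module ℝ V] {Q : LinearMap.BilinForm ℝ V}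

theorem sqrt_bilin_add_le (hs : ∀ v w, Q v w = Q w v) (hn : ∀ v, 0 ≤ Q v v) (v w : V) :
    √(Q (v + w) (v + w)) ≤ √(Q v v) + √(Q w w) := by
  rw [Real.sqrt_le_left (add_nonneg (Real.sqrt_nonneg _) (Real.sqrt_nonneg _)), add_sq,
    Real.sq_sqrt (hn v), Real.sq_sqrt (hn w)]
  have h : Q v w ≤ √(Q v v) * √(Q w w) := by
    rw [← Real.sqrt_mul (hn v)]
    exact Real.le_sqrt_of_sq_le (bilin_cauchySchwarz hs hn v w)
  simp only [map_add, LinearMap.add_apply, hs w v]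
  linarith

end Quadratic

namespace WeightedGraph

variable {X : Type*} {b : WeightedGraph X} {q : X → ℝ}

/-! ### Minimisers of `h(φ) - 2φ(x)` -/

theorem opAt_eq_tsum (x : X) (φ : X →₀ ℝ) :
    b.opAt q x φ = b.diagCoeff q x * φ x - ∑' y, b.weight x y * φ y := by
  rw [b.opAt_apply q x φ φ.support subset_rfl, tsum_eq_sum fun y hy => by
    rw [Finsupp.notMem_support_iff.1 hy, mul_zero]]

/-- u is the pointwise limit of almost minimisers of h(φ) - 2φ(x). The uniform bound makes them
Cauchy at every vertex and bounded, so H passes to the limit, and the approximate Euler-Lagrange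
equation tested with 1_y gives Hu(y). -/
theorem exists_fundamental_solution (hq : b.FormNonneg q) {C : ℝ} (hC : 0 < C)
    (h : ∀ (φ : X →₀ ℝ) (x : X), C * φ x ^ 2 ≤ b.formBilin q φ φ) (x : X) :
    ∃ u : X → ℝ, 0 ≤ u ∧ (∀ y, u y ≤ 2 / C) ∧ u ∈ b.formalDomain ∧
      ∀ y, b.schrodinger q u y = Finsupp.single x (1 : ℝ) y := by
  obtain ⟨d, hd, happ⟩ := exists_isGLB_quadratic (Q := b.formBilin q) (ℓ := Finsupp.lapply x)
    (C := C⁻¹) hq.bilin fun φ => by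
      rw [inv_mul_eq_div, le_div_iff₀ hC, mul_comm]
      exact h φ x
  have hd0 : d ≤ 0 := by simpa using hd 0
  have hpos : ∀ n : ℕ, 0 < 1 / ((n : ℝ) + 1) := fun n => Nat.one_div_pos_of_nat
  choose φ₀ hφ₀ using fun n : ℕ => happ (1 / ((n : ℝ) + 1)) (hpos n)
  -- Taking the modulus lowers h and does not lower φ(x), so the sequence stays minimising and its
  -- limit is nonnegative.
  set φ : ℕ → X →₀ ℝ := fun n => absFinsupp (φ₀ n) with hφdef
  have hφ : ∀ n, b.formBilin q (φ n) (φ n) - 2 * Finsupp.lapply (R := ℝ) x (φ n)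
      ≤ d + 1 / ((n : ℝ) + 1) := by
    intro n
    have h1 := b.formBilin_abs_le q (φ₀ n)
    have h2 := (hφ₀ n).le
    have h3 := le_abs_self (φ₀ n x)
    simp only [Finsupp.lapply_apply, hφdef, absFinsupp_apply] at h2 ⊢
    linarith
  have hlim : Tendsto (fun n : ℕ => 1 / ((n : ℝ) + 1)) atTop (𝓝 0) :=
    tendsto_one_div_add_atTop_nhds_zero_nat
  have hcauchy : ∀ y, CauchySeq fun n => φ n y := by
    intro y
    rw [Metric.cauchySeq_iff']
    intro ε hε
    have hε' : 0 < C * ε ^ 2 / 4 := by positivity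
    obtain ⟨N, hN⟩ := (hlim.eventually (gt_mem_nhds hε')).exists
    refine ⟨N, fun n hn => ?_⟩
    have hn' : 1 / ((n : ℝ) + 1) ≤ 1 / ((N : ℝ) + 1) := Nat.one_div_le_one_div hn
    have h1 := bilin_sub_le_of_almost_minimal hd ((hφ n).trans (by linarith)) (hφ N)
    have h2 := h (φ n - φ N) y
    rw [Real.dist_eq]
    refine abs_lt_of_sq_lt_sq ?_ hε.le
    rw [Finsupp.sub_apply] at h2
    have h3 : C * (φ n y - φ N y) ^ 2 < C * ε ^ 2 := by linarith
    exact lt_of_mul_lt_mul_left h3 hC.le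
  choose u hu using fun y => cauchySeq_tendsto_of_complete (hcauchy y)
  -- As d ≤ 0, almost minimality bounds h(φ_n) by 2φ_n(x) plus the error. In the limit y = x gives
  -- u(x) ≤ 2/C, and this value then bounds u everywhere.
  have hbd : ∀ n y, C * φ n y ^ 2 ≤ 1 / ((n : ℝ) + 1) + 2 * φ n x := by
    intro n y
    have h1 := h (φ n) y
    have h2 := hφ n
    rw [Finsupp.lapply_apply] at h2
    linarith
  have hubd : ∀ y, C * u y ^ 2 ≤ 2 * u x := by
    intro y
    refine le_of_tendsto_of_tendsto' (((hu y).pow 2).const_mul C) ?_ fun n => hbd n y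
    simpa using hlim.add ((hu x).const_mul 2)
  have hu0 : 0 ≤ u := fun y => ge_of_tendsto' (hu y) fun n => abs_nonneg _
  have hux : u x ≤ 2 / C := by
    rw [le_div_iff₀ hC]
    rcases (hu0 x).eq_or_lt with h0 | h0
    · rw [← h0]
      simp
    · have := hubd x
      simp only [Pi.zero_apply] at h0
      nlinarith
  have huy : ∀ y, u y ≤ 2 / C := by
    intro y
    refine le_of_sq_le_sq ?_ (by positivity)
    have h1 := hubd y
    have h2 : C * u y ^ 2 ≤ C * (2 / C) ^ 2 := by
      refine h1.trans ?_
      have : C * (2 / C) ^ 2 = 2 * (2 / C) := by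
        field_simp
      linarith
    exact le_of_mul_le_mul_left h2 hC
  have hdom : u ∈ b.formalDomain := by
    intro y
    refine ((b.summable y).mul_right (2 / C)).of_nonneg_of_le
      (fun z => mul_nonneg (b.nonneg y z) (abs_nonneg _)) fun z => ?_
    rw [abs_of_nonneg (hu0 z)]
    exact mul_le_mul_of_nonneg_left (huy z) (b.nonneg y z)
  refine ⟨u, hu0, huy, hdom, fun y => ?_⟩
  rw [(schrodinger_eq hdom y).2]
  -- A bound uniform in n and z, so that M b(y,·) dominates the sums defining Hφ_n(y).
  obtain ⟨M, hM⟩ : ∃ M : ℝ, ∀ n z, |φ n z| ≤ M := by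
    obtain ⟨B, hB⟩ := (hu x).bddAbove_range
    refine ⟨√((1 + 2 * B) / C), fun n z => Real.abs_le_sqrt ?_⟩
    rw [le_div_iff₀ hC, mul_comm]
    have h1 := hbd n z
    have h2 : φ n x ≤ B := hB ⟨n, rfl⟩
    have h3 : 1 / ((n : ℝ) + 1) ≤ 1 := by
      rw [div_le_one (by positivity)]
      linarith [n.cast_nonneg (α := ℝ)]
    linarith
  have hT1 : Tendsto (fun n => b.opAt q y (φ n)) atTop
      (𝓝 (b.diagCoeff q y * u y - ∑' z, b.weight y z * u z)) := by
    simp only [opAt_eq_tsum]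
    refine ((hu y).const_mul _).sub ?_
    refine tendsto_tsum_of_dominated_convergence ((b.summable y).mul_right M)
      (fun z => (hu z).const_mul _) (Eventually.of_forall fun n z => ?_)
    rw [norm_mul, Real.norm_eq_abs, Real.norm_eq_abs, abs_of_nonneg (b.nonneg y z)]
    exact mul_le_mul_of_nonneg_left (hM n z) (b.nonneg y z)
  have hT2 : Tendsto (fun n => b.opAt q y (φ n)) atTop (𝓝 (Finsupp.single x (1 : ℝ) y)) := by
    have hsq : ∀ n, |b.opAt q y (φ n) - Finsupp.single x (1 : ℝ) y| ≤
        √(1 / ((n : ℝ) + 1) * b.diagCoeff q y) := by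
      intro n
      have h1 := bilin_sq_le_of_almost_minimal (b.formBilin_comm q) hd (hφ n)
        (Finsupp.single y 1)
      rw [formBilin_comm] at h1
      simp only [formBilin_single_left, opAt_single_self, Finsupp.lapply_apply] at h1
      have h2 : Finsupp.single y (1 : ℝ) x = Finsupp.single x (1 : ℝ) y := by
        classical
        simp only [Finsupp.single_apply, eq_comm]
      rw [h2] at h1
      exact Real.abs_le_sqrt h1
    refine tendsto_iff_dist_tendsto_zero.2 (squeeze_zero (fun _ => dist_nonneg) hsq ?_)
    have := (hlim.mul_const (b.diagCoeff q y)).sqrt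
    simpa using this
  exact tendsto_nhds_unique hT1 hT2

/-! ### The extended space -/

/-- The bilinear form `h(φ,ψ) + φ(o)ψ(o)`. -/
def bilinAt (b : WeightedGraph X) (q : X → ℝ) (o : X) : LinearMap.BilinForm ℝ (X →₀ ℝ) :=
  b.formBilin q + (LinearMap.mul ℝ ℝ).compl₁₂ (Finsupp.lapply o) (Finsupp.lapply o)

theorem bilinAt_apply (o : X) (φ ψ : X →₀ ℝ) :
    b.bilinAt q o φ ψ = b.formBilin q φ ψ + φ o * ψ o := rfl

theorem normAt_eq (o : X) (φ : X →₀ ℝ) : b.normAt q o φ = √(b.bilinAt q o φ φ) := by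
  rw [normAt, form_eq_formBilin, bilinAt_apply, sq]

theorem FormNonneg.normAt_add_le (hq : b.FormNonneg q) (o : X) (φ ψ : X →₀ ℝ) :
    b.normAt q o (φ + ψ) ≤ b.normAt q o φ + b.normAt q o ψ := by
  simp only [normAt_eq]
  refine sqrt_bilin_add_le (fun φ ψ => ?_) (fun φ => ?_) φ ψ
  · rw [bilinAt_apply, bilinAt_apply, formBilin_comm, mul_comm]
  · rw [bilinAt_apply]
    exact add_nonneg (hq.bilin φ) (mul_self_nonneg _)

theorem normAt_smul (o : X) {c : ℝ} (hc : 0 ≤ c) (φ : X →₀ ℝ) :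
    b.normAt q o (c • φ) = c * b.normAt q o φ := by
  rw [normAt_eq, normAt_eq]
  simp only [map_smul, LinearMap.smul_apply, smul_eq_mul]
  rw [← mul_assoc, Real.sqrt_mul (mul_self_nonneg c), Real.sqrt_mul_self hc]

theorem normAt_neg (o : X) (φ : X →₀ ℝ) : b.normAt q o (-φ) = b.normAt q o φ := by
  rw [normAt_eq, normAt_eq]
  simp

theorem normAt_abs_le (o : X) (φ : X →₀ ℝ) :
    b.normAt q o (absFinsupp φ) ≤ b.normAt q o φ := by
  rw [normAt, normAt, form_eq_formBilin, form_eq_formBilin, absFinsupp_apply, sq_abs]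
  exact Real.sqrt_le_sqrt (add_le_add_left (b.formBilin_abs_le q φ) _)

/-- The bound makes a form-Cauchy sequence uniformly Cauchy, so one of its members approximates the
limit uniformly. -/
theorem extendedSpace_subset_C0 (hq : b.FormNonneg q) {C : ℝ} (hC : 0 < C)
    (h : ∀ (φ : X →₀ ℝ) (x : X), C * φ x ^ 2 ≤ b.formBilin q φ φ) (o : X) :
    b.extendedSpace q o ⊆ C0 X := by
  rintro f ⟨φ, hφ, hf⟩ ε hε
  obtain ⟨N, hN⟩ := hφ (√C * ε) (by positivity)
  refine ⟨φ N, fun x => ?_⟩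
  refine le_of_tendsto ((hf x).sub_const (φ N x)).abs ?_
  filter_upwards [eventually_ge_atTop N] with n hn
  have h1 := hN n hn N le_rfl
  have h2 := h (φ n - φ N) x
  have h3 := hq.normAt_sq o (φ n - φ N)
  have h4 : b.normAt q o (φ n - φ N) ^ 2 ≤ (√C * ε) ^ 2 :=
    pow_le_pow_left₀ (Real.sqrt_nonneg _) h1.le 2
  rw [mul_pow, Real.sq_sqrt hC.le] at h4
  refine abs_le_of_sq_le_sq ?_ hε.le
  rw [Finsupp.sub_apply] at h2
  refine le_of_mul_le_mul_left ?_ hC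
  linarith [sq_nonneg ((φ n - φ N) o)]

/-- The partial sums are Cauchy by comparison with a geometric series, and the Harnack inequality
turns this into pointwise convergence. Nonnegative terms make the sum dominate each of them. -/
theorem exists_sum_mem_extendedSpace (hq : b.FormNonneg q) (hb : b.Connected) (o : X)
    (ψ : ℕ → X →₀ ℝ) (hψ0 : ∀ n x, 0 ≤ ψ n x) (hψ : ∀ n, b.normAt q o (ψ n) ≤ (1 / 2) ^ n) :
    ∃ f ∈ b.extendedSpace q o, ∀ n x, ψ n x ≤ f x := by
  set s : ℕ → X →₀ ℝ := fun n => ∑ k ∈ Finset.range n, ψ k with hs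
  have hstep : ∀ n k, b.normAt q o (s (n + k) - s n) ≤ 2 * (1 / 2) ^ n - 2 * (1 / 2) ^ (n + k) := by
    intro n k
    induction k with
    | zero => simp [normAt_eq]
    | succ k ih =>
      have h1 : s (n + (k + 1)) - s n = (s (n + k) - s n) + ψ (n + k) := by
        simp only [hs, ← add_assoc, Finset.sum_range_succ]
        abel
      rw [h1]
      refine (hq.normAt_add_le o _ _).trans ?_
      have h2 := hψ (n + k)
      have h3 : (1 / 2 : ℝ) ^ (n + (k + 1)) = (1 / 2) ^ (n + k) / 2 := by
        rw [← add_assoc, pow_succ]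
        ring
      rw [h3]
      linarith
  have hle : ∀ n m, n ≤ m → b.normAt q o (s m - s n) ≤ 2 * (1 / 2) ^ n := by
    intro n m hnm
    obtain ⟨k, rfl⟩ := Nat.exists_eq_add_of_le hnm
    refine (hstep n k).trans ?_
    have : (0 : ℝ) ≤ 2 * (1 / 2) ^ (n + k) := by positivity
    linarith
  have hlim : Tendsto (fun n : ℕ => 2 * (1 / 2 : ℝ) ^ n) atTop (𝓝 0) := by
    simpa using (tendsto_pow_atTop_nhds_zero_of_lt_one (r := (1 / 2 : ℝ)) (by norm_num)
      (by norm_num)).const_mul 2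
  have hcauchy : ∀ ε : ℝ, 0 < ε → ∃ N, ∀ m ≥ N, ∀ n ≥ N, b.normAt q o (s m - s n) < ε := by
    intro ε hε
    obtain ⟨N, hN⟩ := (hlim.eventually (gt_mem_nhds (half_pos hε))).exists
    refine ⟨N, fun m hm n hn => ?_⟩
    have h1 : s m - s n = (s m - s N) + -(s n - s N) := by abel
    rw [h1]
    refine (hq.normAt_add_le o _ _).trans_lt ?_
    rw [normAt_neg]
    linarith [hle N m hm, hle N n hn]
  have hpt : ∀ x, CauchySeq fun n => s n x := by
    intro x
    obtain ⟨C, hC, h⟩ := hq.exists_bound_normAt hb o x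
    rw [Metric.cauchySeq_iff]
    intro ε hε
    obtain ⟨N, hN⟩ := hcauchy (ε / C) (by positivity)
    refine ⟨N, fun m hm n hn => ?_⟩
    rw [Real.dist_eq, ← Finsupp.sub_apply]
    refine (h _).trans_lt ?_
    have := hN m hm n hn
    rwa [lt_div_iff₀' hC] at this
  choose f hf using fun x => cauchySeq_tendsto_of_complete (hpt x)
  refine ⟨f, ⟨s, hcauchy, hf⟩, fun n x => ?_⟩
  refine ge_of_tendsto (hf x) ?_
  filter_upwards [eventually_gt_atTop n] with m hm
  simp only [hs, Finsupp.finsetSum_apply]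
  exact Finset.single_le_sum (f := fun k => ψ k x) (fun k _ => hψ0 k x) (Finset.mem_range.2 hm)

/-- If no constant works, there are nonnegative functions of norm at most 2^{-n} taking the value n
somewhere. Their sum lies in the extended space but is unbounded, whereas functions in C_0(X) are
bounded. -/
theorem exists_bound_of_extendedSpace_subset [Nonempty X] (hq : b.FormNonneg q)
    (hb : b.Connected) (o : X) (h : b.extendedSpace q o ⊆ C0 X) :
    ∃ C : ℝ, 0 < C ∧ ∀ φ : X →₀ ℝ, C * supNorm φ ^ 2 ≤ b.normAt q o φ ^ 2 := by
  by_contra! hcon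
  have hψ : ∀ n : ℕ, ∃ ψ : X →₀ ℝ, (∀ x, 0 ≤ ψ x) ∧ b.normAt q o ψ ≤ (1 / 2) ^ n ∧
      ∃ x, ψ x = n := by
    intro n
    -- After rescaling |φ| to maximum n the norm is at most n/(n+1) · 2^{-n}.
    obtain ⟨φ, hφ⟩ := hcon (((1 / 2) ^ n / (n + 1)) ^ 2) (by positivity)
    rw [← mul_pow] at hφ
    have hS0 : 0 ≤ supNorm φ := by
      obtain ⟨x, hx⟩ := supNorm_eq_abs φ
      rw [hx]
      exact abs_nonneg _
    have h1 := lt_of_pow_lt_pow_left₀ 2 (mul_nonneg (by positivity) hS0) hφ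
    have hS : 0 < supNorm φ := by
      refine lt_of_le_of_ne hS0 fun h0 => ?_
      rw [← h0, mul_zero] at h1
      exact absurd h1 (not_lt.2 (Real.sqrt_nonneg _))
    obtain ⟨x, hx⟩ := supNorm_eq_abs φ
    have hc : 0 ≤ (n : ℝ) / supNorm φ := by positivity
    refine ⟨((n : ℝ) / supNorm φ) • absFinsupp φ, fun y => ?_, ?_, x, ?_⟩
    · exact mul_nonneg hc (abs_nonneg _)
    · rw [normAt_smul o hc]
      have h2 := (normAt_abs_le (b := b) (q := q) o φ).trans h1.le
      refine (mul_le_mul_of_nonneg_left h2 hc).trans ?_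
      have h3 : (n : ℝ) / supNorm φ * ((1 / 2) ^ n / (n + 1) * supNorm φ)
          = (n / (n + 1)) * (1 / 2) ^ n := by
        field_simp
      rw [h3]
      refine mul_le_of_le_one_left (by positivity) ?_
      rw [div_le_one (by positivity)]
      linarith
    · rw [Finsupp.smul_apply, absFinsupp_apply, ← hx, smul_eq_mul, div_mul_cancel₀ _ hS.ne']
  choose ψ hψ0 hψn x hx using hψ
  obtain ⟨f, hf, hle⟩ := exists_sum_mem_extendedSpace hq hb o ψ hψ0 hψn
  obtain ⟨φ, hφ⟩ := h hf 1 one_pos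
  obtain ⟨n, hn⟩ := exists_nat_gt (supNorm φ + 1)
  have h1 := (hx n).symm.le.trans (hle n (x n))
  have h2 := abs_le_supNorm φ (x n)
  have h3 := (le_abs_self _).trans (hφ (x n))
  have h4 := le_abs_self (φ (x n))
  linarith

end WeightedGraph

/-! ### Nonnegative self-adjoint operators, given by their graphs -/

section Resolvent

variable {E : Type*} [NormedAddCommGroup E] [InnerProductSpace ℝ E]

/-- `Γ` is the graph of a nonnegative self-adjoint operator, stated through solvability of
`u + s A u = f`. -/
structure IsNonnegSelfAdjointGraph (Γ : Submodule ℝ (E × E)) : Prop where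
  nonneg : ∀ p ∈ Γ, 0 ≤ inner ℝ p.2 p.1
  symm : ∀ p ∈ Γ, ∀ r ∈ Γ, inner ℝ p.2 r.1 = inner ℝ p.1 r.2
  exists_add_smul_eq : ∀ s : ℝ, 0 < s → ∀ f, ∃ p ∈ Γ, p.1 + s • p.2 = f
  eq_zero : ∀ g, ((0 : E), g) ∈ Γ → g = 0

/-- `R s` is the resolvent `(1 + s A)⁻¹` for `s > 0`. -/
def IsResolventFamily (Γ : Submodule ℝ (E × E)) (R : ℝ → E →L[ℝ] E) : Prop :=
  ∀ s > 0, ∀ f, (R s f, s⁻¹ • (f - R s f)) ∈ Γ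

namespace IsNonnegSelfAdjointGraph

variable {Γ : Submodule ℝ (E × E)}

theorem norm_fst_le (hΓ : IsNonnegSelfAdjointGraph Γ) {s : ℝ} (hs : 0 < s) {p : E × E}
    (hp : p ∈ Γ) : ‖p.1‖ ≤ ‖p.1 + s • p.2‖ := by
  refine le_of_sq_le_sq ?_ (norm_nonneg _)
  rw [norm_add_sq_real, inner_smul_right, real_inner_comm]
  have := hΓ.nonneg p hp
  have h2 : 0 ≤ s * inner ℝ p.2 p.1 := mul_nonneg hs.le this
  linarith [sq_nonneg ‖s • p.2‖]

theorem eq_of_add_smul_eq (hΓ : IsNonnegSelfAdjointGraph Γ) {s : ℝ} (hs : 0 < s) {p r : E × E}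
    (hp : p ∈ Γ) (hr : r ∈ Γ) (h : p.1 + s • p.2 = r.1 + s • r.2) : p.1 = r.1 := by
  have h1 := hΓ.norm_fst_le hs (Γ.sub_mem hp hr)
  have h2 : (p - r).1 + s • (p - r).2 = 0 := by
    rw [Prod.fst_sub, Prod.snd_sub, smul_sub, ← sub_eq_zero.2 h]
    abel
  rw [h2, norm_zero, norm_le_zero_iff, Prod.fst_sub] at h1
  exact sub_eq_zero.1 h1

theorem exists_resolventFamily (hΓ : IsNonnegSelfAdjointGraph Γ) :
    ∃ R : ℝ → E →L[ℝ] E, IsResolventFamily Γ R := by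
  have key : ∀ s : ℝ, ∃ T : E →L[ℝ] E, 0 < s → ∀ f, (T f, s⁻¹ • (f - T f)) ∈ Γ := by
    intro s
    by_cases hs : 0 < s
    · choose p hp hps using hΓ.exists_add_smul_eq s hs
      have hadd : ∀ f g, (p (f + g)).1 = (p f).1 + (p g).1 := fun f g =>
        hΓ.eq_of_add_smul_eq hs (hp (f + g)) (Γ.add_mem (hp f) (hp g)) (by
          rw [hps, Prod.fst_add, Prod.snd_add, smul_add]
          nth_rewrite 1 [← hps f, ← hps g]
          abel)
      have hsmul : ∀ (c : ℝ) f, (p (c • f)).1 = c • (p f).1 := fun c f =>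
        hΓ.eq_of_add_smul_eq hs (hp (c • f)) (Γ.smul_mem c (hp f)) (by
          rw [hps, Prod.smul_fst, Prod.smul_snd, smul_comm s c, ← smul_add, hps])
      let L : E →ₗ[ℝ] E :=
        { toFun := fun f => (p f).1, map_add' := hadd, map_smul' := hsmul }
      refine ⟨L.mkContinuous 1 fun f => ?_, fun _ f => ?_⟩
      · have := hΓ.norm_fst_le hs (hp f)
        rw [hps] at this
        rwa [one_mul]
      · have h1 : s⁻¹ • (f - (p f).1) = (p f).2 := by
          nth_rewrite 1 [← hps f]
          rw [add_sub_cancel_left, smul_smul, inv_mul_cancel₀ hs.ne', one_smul]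
        change ((p f).1, s⁻¹ • (f - (p f).1)) ∈ Γ
        rw [h1]
        exact hp f
    · exact ⟨0, fun h => absurd h hs⟩
  choose R hR using key
  exact ⟨R, hR⟩

end IsNonnegSelfAdjointGraph

namespace IsResolventFamily

variable {Γ : Submodule ℝ (E × E)} {R : ℝ → E →L[ℝ] E}

theorem apply_add_smul (hR : IsResolventFamily Γ R) (hΓ : IsNonnegSelfAdjointGraph Γ) {s : ℝ}
    (hs : 0 < s) {u g : E} (h : (u, g) ∈ Γ) : R s (u + s • g) = u := by
  refine hΓ.eq_of_add_smul_eq hs (hR s hs (u + s • g)) h ?_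
  simp only
  rw [smul_smul, mul_inv_cancel₀ hs.ne', one_smul]
  abel

theorem sub_apply (hR : IsResolventFamily Γ R) (hΓ : IsNonnegSelfAdjointGraph Γ) {s : ℝ}
    (hs : 0 < s) {u g : E} (h : (u, g) ∈ Γ) : u - R s u = s • R s g := by
  have := hR.apply_add_smul hΓ hs h
  rw [map_add, map_smul] at this
  nth_rewrite 1 [← this]
  abel

theorem apply_mem (hR : IsResolventFamily Γ R) (hΓ : IsNonnegSelfAdjointGraph Γ) {s : ℝ}
    (hs : 0 < s) {u g : E} (h : (u, g) ∈ Γ) : (R s u, R s g) ∈ Γ := by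
  have h1 := hR s hs u
  rwa [hR.sub_apply hΓ hs h, smul_smul, inv_mul_cancel₀ hs.ne', one_smul] at h1

/-- A resolvent maps the graph into itself, so R_s R_r f solves the equation that characterises R_r
R_s f. -/
theorem commute (hR : IsResolventFamily Γ R) (hΓ : IsNonnegSelfAdjointGraph Γ) {s r : ℝ}
    (hs : 0 < s) (hr : 0 < r) : Commute (R s) (R r) := by
  refine ContinuousLinearMap.ext fun f => ?_
  change R s (R r f) = R r (R s f)
  have h1 := hR.apply_mem hΓ hs (hR r hr f)
  have h2 := hR.apply_add_smul hΓ hr h1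
  rw [← map_smul, smul_smul, mul_inv_cancel₀ hr.ne', one_smul, ← map_add,
    add_sub_cancel] at h2
  exact h2.symm

theorem norm_apply_le (hR : IsResolventFamily Γ R) (hΓ : IsNonnegSelfAdjointGraph Γ) {s : ℝ}
    (hs : 0 < s) (f : E) : ‖R s f‖ ≤ ‖f‖ := by
  have h := hΓ.norm_fst_le hs (hR s hs f)
  simp only at h
  rwa [smul_smul, mul_inv_cancel₀ hs.ne', one_smul, add_sub_cancel] at h

theorem norm_pow_apply_le_of {T : E →L[ℝ] E} (hT : ∀ f, ‖T f‖ ≤ ‖f‖) (n : ℕ) (f : E) :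
    ‖(T ^ n) f‖ ≤ ‖f‖ := by
  induction n with
  | zero => simp
  | succ n ih =>
    rw [pow_succ']
    exact (hT _).trans ih

theorem norm_pow_apply_le (hR : IsResolventFamily Γ R) (hΓ : IsNonnegSelfAdjointGraph Γ) {s : ℝ}
    (hs : 0 < s) (n : ℕ) (f : E) : ‖(R s ^ n) f‖ ≤ ‖f‖ :=
  norm_pow_apply_le_of (hR.norm_apply_le hΓ hs) n f

theorem inner_apply (hR : IsResolventFamily Γ R) (hΓ : IsNonnegSelfAdjointGraph Γ) {s : ℝ}
    (hs : 0 < s) (f g : E) : inner ℝ (R s f) g = inner ℝ f (R s g) := by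
  have h := hΓ.symm _ (hR s hs f) _ (hR s hs g)
  simp only [inner_smul_left, inner_smul_right, inner_sub_left, inner_sub_right,
    RCLike.conj_to_real] at h
  have := mul_left_cancel₀ (inv_ne_zero hs.ne') h
  linarith

theorem inner_pow_apply (hR : IsResolventFamily Γ R) (hΓ : IsNonnegSelfAdjointGraph Γ) {s : ℝ}
    (hs : 0 < s) (n : ℕ) (f g : E) : inner ℝ ((R s ^ n) f) g = inner ℝ f ((R s ^ n) g) := by
  induction n generalizing g with
  | zero => simp
  | succ n ih =>
    nth_rewrite 1 [pow_succ']
    rw [mul_apply_eq_comp, hR.inner_apply hΓ hs, ih, pow_succ]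
    rfl

theorem inner_apply_self_nonneg (hR : IsResolventFamily Γ R) (hΓ : IsNonnegSelfAdjointGraph Γ)
    {s : ℝ} (hs : 0 < s) (f : E) : 0 ≤ inner ℝ (R s f) f := by
  have h := hΓ.nonneg _ (hR s hs f)
  simp only [inner_smul_left, inner_sub_left, RCLike.conj_to_real] at h
  have h1 := (mul_nonneg_iff_of_pos_left (inv_pos.2 hs)).1 h
  rw [real_inner_self_eq_norm_sq, real_inner_comm] at h1
  nlinarith [sq_nonneg ‖R s f‖]

/-- By symmetry half of the powers move to the other side, leaving a square norm or, for odd n, one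
remaining positive factor R_s. -/
theorem inner_pow_apply_self_nonneg (hR : IsResolventFamily Γ R)
    (hΓ : IsNonnegSelfAdjointGraph Γ) {s : ℝ} (hs : 0 < s) (n : ℕ) (f : E) :
    0 ≤ inner ℝ ((R s ^ n) f) f := by
  rcases n.even_or_odd' with ⟨k, rfl | rfl⟩
  · rw [two_mul, pow_add, mul_apply_eq_comp, hR.inner_pow_apply hΓ hs]
    exact real_inner_self_nonneg
  · rw [two_mul, pow_succ', pow_add, ← mul_assoc, ← pow_succ', pow_succ, mul_assoc,
      mul_apply_eq_comp, hR.inner_pow_apply hΓ hs, mul_apply_eq_comp]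
    exact hR.inner_apply_self_nonneg hΓ hs _

/-! ### Comparison of powers of resolvents -/

theorem norm_sub_apply_le (hR : IsResolventFamily Γ R) (hΓ : IsNonnegSelfAdjointGraph Γ) {s : ℝ}
    (hs : 0 < s) {u g : E} (h : (u, g) ∈ Γ) : ‖u - R s u‖ ≤ s * ‖g‖ := by
  rw [hR.sub_apply hΓ hs h, norm_smul, Real.norm_of_nonneg hs.le]
  exact mul_le_mul_of_nonneg_left (hR.norm_apply_le hΓ hs g) hs.le

theorem norm_sub_pow_apply_le (hR : IsResolventFamily Γ R) (hΓ : IsNonnegSelfAdjointGraph Γ)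
    {s : ℝ} (hs : 0 < s) {u g : E} (h : (u, g) ∈ Γ) (n : ℕ) :
    ‖u - (R s ^ n) u‖ ≤ n * (s * ‖g‖) := by
  induction n with
  | zero => simp
  | succ n ih =>
    have h1 : u - (R s ^ (n + 1)) u = (u - (R s ^ n) u) + (R s ^ n) (u - R s u) := by
      rw [map_sub, pow_succ, mul_apply_eq_comp]
      abel
    rw [h1]
    refine (norm_add_le _ _).trans ?_
    have h2 := (hR.norm_pow_apply_le hΓ hs n (u - R s u)).trans (hR.norm_sub_apply_le hΓ hs h)
    rw [Nat.cast_add_one]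
    linarith

/-- First-order expansion on the domain of A², with g = Au and k = A²u. Passing from n to n + 1 adds
s(g - R_s^{n+1} g), which is at most (n+1) s² ‖k‖ in norm. -/
theorem norm_taylor_le (hR : IsResolventFamily Γ R) (hΓ : IsNonnegSelfAdjointGraph Γ)
    {s : ℝ} (hs : 0 < s) {u g k : E} (h : (u, g) ∈ Γ) (h' : (g, k) ∈ Γ) (n : ℕ) :
    ‖(R s ^ n) u - u + (n * s) • g‖ ≤ (n * s) ^ 2 * ‖k‖ := by
  induction n with
  | zero => simp
  | succ n ih =>
    have h1 : (R s ^ (n + 1)) u - u + ((n + 1 : ℕ) * s) • g =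
        ((R s ^ n) u - u + (n * s) • g) + s • (g - (R s ^ (n + 1)) g) := by
      have h2 : (R s ^ (n + 1)) u = (R s ^ n) u - s • (R s ^ (n + 1)) g := by
        have h3 : R s u = u - s • R s g := by
          rw [← hR.sub_apply hΓ hs h]
          abel
        rw [pow_succ, mul_apply_eq_comp, h3, map_sub, map_smul,
          mul_apply_eq_comp]
      rw [h2]
      push_cast
      module
    rw [h1]
    refine (norm_add_le _ _).trans ?_
    rw [norm_smul, Real.norm_of_nonneg hs.le]
    have h4 := mul_le_mul_of_nonneg_left (hR.norm_sub_pow_apply_le hΓ hs h' (n + 1)) hs.le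
    rw [Nat.cast_add_one] at h4 ⊢
    have h5 : 0 ≤ (n : ℝ) * (s ^ 2 * ‖k‖) := by positivity
    nlinarith

/-- Telescoping for commuting contractions. -/
theorem norm_pow_sub_pow_le {U W : E →L[ℝ] E} (hU : ∀ f, ‖U f‖ ≤ ‖f‖) (hW : ∀ f, ‖W f‖ ≤ ‖f‖)
    (hUW : Commute U W) (n : ℕ) (f : E) : ‖(U ^ n) f - (W ^ n) f‖ ≤ n * ‖U f - W f‖ := by
  induction n with
  | zero => simp
  | succ n ih =>
    have h1 : (U ^ (n + 1)) f - (W ^ (n + 1)) f =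
        (U ^ n) (U f - W f) + W ((U ^ n) f - (W ^ n) f) := by
      have h2 : (U ^ n) (W f) = W ((U ^ n) f) :=
        congrArg (fun T : E →L[ℝ] E => T f) (hUW.pow_left n).eq
      rw [map_sub, map_sub, h2, pow_succ, pow_succ', mul_apply_eq_comp,
        mul_apply_eq_comp]
      abel
    rw [h1]
    refine (norm_add_le _ _).trans ?_
    have h3 := norm_pow_apply_le_of hU n (U f - W f)
    have h4 := (hW ((U ^ n) f - (W ^ n) f)).trans ih
    rw [Nat.cast_add_one]
    linarith

/-- One step of length s and m steps of length s/m have the same first-order part u - s g, so they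
differ by at most 2s²‖k‖; n such steps multiply this by at most n. -/
theorem norm_pow_sub_pow_mul_le (hR : IsResolventFamily Γ R) (hΓ : IsNonnegSelfAdjointGraph Γ)
    {s : ℝ} (hs : 0 < s) {u g k : E} (h : (u, g) ∈ Γ) (h' : (g, k) ∈ Γ) (n : ℕ) {m : ℕ}
    (hm : 0 < m) : ‖(R s ^ n) u - (R (s / m) ^ (m * n)) u‖ ≤ 2 * n * s ^ 2 * ‖k‖ := by
  have hm' : (0 : ℝ) < m := Nat.cast_pos.2 hm
  have hsm : 0 < s / m := div_pos hs hm'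
  rw [pow_mul]
  refine (norm_pow_sub_pow_le (hR.norm_apply_le hΓ hs) (hR.norm_pow_apply_le hΓ hsm m)
    ((hR.commute hΓ hs hsm).pow_right m) n u).trans ?_
  have h1 := hR.norm_taylor_le hΓ hs h h' 1
  have h2 := hR.norm_taylor_le hΓ hsm h h' m
  rw [mul_div_cancel₀ _ hm'.ne'] at h2
  simp only [pow_one, Nat.cast_one, one_mul] at h1
  have h3 : R s u - (R (s / m) ^ m) u =
      (R s u - u + s • g) - ((R (s / m) ^ m) u - u + s • g) := by abel
  have h4 : ‖R s u - (R (s / m) ^ m) u‖ ≤ s ^ 2 * ‖k‖ + s ^ 2 * ‖k‖ := by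
    rw [h3]
    exact (norm_sub_le _ _).trans (add_le_add h1 h2)
  have h5 := mul_le_mul_of_nonneg_left h4 (Nat.cast_nonneg (α := ℝ) n)
  linarith

theorem norm_apply_sub_apply_le (hR : IsResolventFamily Γ R) (hΓ : IsNonnegSelfAdjointGraph Γ)
    {s r : ℝ} (hs : 0 < s) (hr : 0 < r) {u g : E} (h : (u, g) ∈ Γ) :
    ‖R s u - R r u‖ ≤ |s - r| * ‖g‖ := by
  have h1 := hR.sub_apply hΓ hs (hR.apply_mem hΓ hr h)
  have h2 := hR.sub_apply hΓ hr (hR.apply_mem hΓ hs h)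
  have h3 : ∀ v, R s (R r v) = R r (R s v) := fun v =>
    congrArg (fun T : E →L[ℝ] E => T v) (hR.commute hΓ hs hr).eq
  rw [h3, h3] at h1
  have h4 : R s u - R r u = (r - s) • R r (R s g) := by
    rw [sub_smul, ← h1, ← h2]
    abel
  rw [h4, norm_smul, Real.norm_eq_abs, abs_sub_comm]
  exact mul_le_mul_of_nonneg_left
    ((hR.norm_apply_le hΓ hr _).trans (hR.norm_apply_le hΓ hs _)) (abs_nonneg _)

/-- Both discretisations are refined to m n steps, of lengths s/m and r/n; the refined ones are
compared through the Lipschitz dependence of the resolvent on its step. -/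
theorem norm_pow_sub_pow_le_of_mem (hR : IsResolventFamily Γ R)
    (hΓ : IsNonnegSelfAdjointGraph Γ) {s r : ℝ} (hs : 0 < s) (hr : 0 < r) {u g k : E}
    (h : (u, g) ∈ Γ) (h' : (g, k) ∈ Γ) {n m : ℕ} (hn : 0 < n) (hm : 0 < m) :
    ‖(R s ^ n) u - (R r ^ m) u‖ ≤
      2 * n * s ^ 2 * ‖k‖ + 2 * m * r ^ 2 * ‖k‖ + |n * s - m * r| * ‖g‖ := by
  have hn' : (0 : ℝ) < n := Nat.cast_pos.2 hn
  have hm' : (0 : ℝ) < m := Nat.cast_pos.2 hm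
  have hsm := div_pos hs hm'
  have hrn := div_pos hr hn'
  have h1 := hR.norm_pow_sub_pow_mul_le hΓ hs h h' n hm
  have h2 := hR.norm_pow_sub_pow_mul_le hΓ hr h h' m hn
  have h3 := norm_pow_sub_pow_le (hR.norm_apply_le hΓ hsm) (hR.norm_apply_le hΓ hrn)
    (hR.commute hΓ hsm hrn) (m * n) u
  have h4 : ((m * n : ℕ) : ℝ) * (|s / m - r / n| * ‖g‖) = |n * s - m * r| * ‖g‖ := by
    rw [← mul_assoc]
    congr 1
    rw [← abs_of_nonneg (Nat.cast_nonneg (α := ℝ) (m * n)), ← abs_mul]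
    congr 1
    push_cast
    field_simp
  have h5 := h3.trans (mul_le_mul_of_nonneg_left (hR.norm_apply_sub_apply_le hΓ hsm hrn h)
    (Nat.cast_nonneg _))
  rw [h4] at h5
  rw [mul_comm n m] at h2
  have h6 : (R s ^ n) u - (R r ^ m) u =
      ((R s ^ n) u - (R (s / m) ^ (m * n)) u) +
      ((R (s / m) ^ (m * n)) u - (R (r / n) ^ (m * n)) u) -
      ((R r ^ m) u - (R (r / n) ^ (m * n)) u) := by abel
  rw [h6]
  refine (norm_sub_le _ _).trans ?_
  have h7 := norm_add_le ((R s ^ n) u - (R (s / m) ^ (m * n)) u)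
    ((R (s / m) ^ (m * n)) u - (R (r / n) ^ (m * n)) u)
  linarith

end IsResolventFamily

end Resolvent

section Semigroup

variable {E : Type*} [NormedAddCommGroup E] [InnerProductSpace ℝ E]
  {Γ : Submodule ℝ (E × E)} {R : ℝ → E →L[ℝ] E}

/-- `P` is the semigroup of the operator with resolvents `R`. -/
def IsSemigroupLimit (R : ℝ → E →L[ℝ] E) (P : ℝ → E → E) : Prop :=
  ∀ t > 0, ∀ (s : ℕ → ℝ) (n : ℕ → ℕ), (∀ᶠ k in atTop, 0 < s k) →
      (∀ᶠ k in atTop, 0 < n k) → Tendsto s atTop (𝓝 0) →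
      Tendsto (fun k => n k * s k) atTop (𝓝 t) →
      ∀ f, Tendsto (fun k => (R (s k) ^ n k) f) atTop (𝓝 (P t f))

namespace IsResolventFamily

/-! ### The semigroup -/

/-- For f orthogonal to the range, ⟨R_1 f, f⟩ = 0 and nonnegativity force R_1 f = 0. Then (0, f)
lies in the graph, so f = 0. -/
theorem denseRange_one [CompleteSpace E] (hR : IsResolventFamily Γ R)
    (hΓ : IsNonnegSelfAdjointGraph Γ) : DenseRange (R 1) := by
  have h1 : (LinearMap.range (R 1).toLinearMap)ᗮ = ⊥ := by
    refine (Submodule.eq_bot_iff _).2 fun f hf => ?_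
    have h2 : inner ℝ (R 1 f) f = 0 := (Submodule.mem_orthogonal _ _).1 hf _ ⟨f, rfl⟩
    have h3 := hR 1 one_pos f
    rw [inv_one, one_smul] at h3
    have h4 := hΓ.nonneg _ h3
    simp only [inner_sub_left] at h4
    rw [real_inner_self_eq_norm_sq, real_inner_comm, h2, zero_sub, Left.nonneg_neg_iff] at h4
    have h5 : R 1 f = 0 := norm_eq_zero.1 (pow_eq_zero_iff two_ne_zero |>.1
      (le_antisymm h4 (sq_nonneg _)))
    rw [h5, sub_zero] at h3
    exact hΓ.eq_zero f h3
  have h2 := Submodule.topologicalClosure_eq_top_iff.2 h1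
  rw [← Submodule.dense_iff_topologicalClosure_eq_top] at h2
  exact h2

theorem exists_norm_sub_lt [CompleteSpace E] (hR : IsResolventFamily Γ R)
    (hΓ : IsNonnegSelfAdjointGraph Γ) (f : E) {ε : ℝ} (hε : 0 < ε) :
    ∃ u g k, (u, g) ∈ Γ ∧ (g, k) ∈ Γ ∧ ‖f - u‖ < ε := by
  have hd := hR.denseRange_one hΓ
  obtain ⟨v, hv⟩ := (hd.comp hd (R 1).continuous).exists_dist_lt f hε
  have h1 : ∀ w, (R 1 w, w - R 1 w) ∈ Γ := fun w => by
    simpa using hR 1 one_pos w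
  refine ⟨R 1 (R 1 v), R 1 v - R 1 (R 1 v), (v - R 1 v) - R 1 (v - R 1 v), h1 (R 1 v), ?_, ?_⟩
  · rw [← map_sub]
    exact h1 _
  · rwa [dist_eq_norm] at hv

theorem exists_pos_norm_pow_sub_pow_lt [CompleteSpace E] (hR : IsResolventFamily Γ R)
    (hΓ : IsNonnegSelfAdjointGraph Γ) (f : E) {t ε : ℝ} (ht : 0 < t) (hε : 0 < ε) :
    ∃ δ > 0, ∀ s r : ℝ, ∀ n m : ℕ, 0 < s → s < δ → 0 < r → r < δ → 0 < n → 0 < m →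
      |n * s - t| < δ → |m * r - t| < δ → ‖(R s ^ n) f - (R r ^ m) f‖ < ε := by
  obtain ⟨u, g, k, hu, hg, hfu⟩ := hR.exists_norm_sub_lt hΓ f (ε := ε / 4) (by positivity)
  -- Each second-order error is at most 2(t+1)δ‖k‖ and the time mismatch costs 2δ‖g‖; the final 1
  -- keeps B positive.
  set B := 4 * (t + 1) * ‖k‖ + 2 * ‖g‖ + 1 with hB
  have hB0 : 0 < B := by positivity
  refine ⟨min 1 (ε / 2 / B), by positivity, fun s r n m hs hsδ hr hrδ hn hm hns hmr => ?_⟩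
  set δ := min 1 (ε / 2 / B) with hδ
  have hδ1 : δ ≤ 1 := min_le_left _ _
  have hδ0 : 0 < δ := hs.trans hsδ
  have hδB : δ * B ≤ ε / 2 := by
    rw [← le_div_iff₀ hB0]
    exact min_le_right _ _
  have h1 := hR.norm_pow_sub_pow_le_of_mem hΓ hs hr hu hg hn hm
  have h2 := hR.norm_pow_apply_le hΓ hs n (f - u)
  have h3 := hR.norm_pow_apply_le hΓ hr m (f - u)
  have h4 : (R s ^ n) f - (R r ^ m) f =
      (R s ^ n) (f - u) + ((R s ^ n) u - (R r ^ m) u) - (R r ^ m) (f - u) := by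
    rw [map_sub, map_sub]
    abel
  have aux : ∀ (s : ℝ) (n : ℕ), 0 < s → s < δ → |n * s - t| < δ →
      2 * n * s ^ 2 * ‖k‖ ≤ 2 * (t + 1) * δ * ‖k‖ := by
    intro s n hs hsδ hns
    refine mul_le_mul_of_nonneg_right ?_ (norm_nonneg k)
    have h5 : n * s ≤ t + 1 := by linarith [(abs_lt.1 hns).2]
    have h6 : (n * s) * s ≤ (t + 1) * δ :=
      mul_le_mul h5 hsδ.le hs.le (by positivity)
    linarith
  have h7 : |n * s - m * r| ≤ 2 * δ := by
    have := abs_sub_le (n * s) t (m * r)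
    rw [abs_sub_comm t] at this
    linarith
  have h8 := mul_le_mul_of_nonneg_right h7 (norm_nonneg g)
  rw [h4]
  have h9 := norm_sub_le ((R s ^ n) (f - u) + ((R s ^ n) u - (R r ^ m) u)) ((R r ^ m) (f - u))
  have h10 := norm_add_le ((R s ^ n) (f - u)) ((R s ^ n) u - (R r ^ m) u)
  have h11 := aux s n hs hsδ hns
  have h12 := aux r m hr hrδ hmr
  have h13 : 4 * (t + 1) * δ * ‖k‖ + 2 * δ * ‖g‖ + δ ≤ ε / 2 := by
    have : 4 * (t + 1) * δ * ‖k‖ + 2 * δ * ‖g‖ + δ = δ * B := by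
      rw [hB]
      ring
    linarith
  linarith

/-- The limit is the same for all discretisations of the time t. Besides k steps of length t/k, this
serves steps of one length for all t, which gives measurability and Riemann sums, and 2k steps of
length t/k for the time 2t. -/
theorem exists_semigroup [CompleteSpace E] (hR : IsResolventFamily Γ R)
    (hΓ : IsNonnegSelfAdjointGraph Γ) :
    ∃ P : ℝ → E → E, IsSemigroupLimit R P := by
  have key : ∀ t > 0, ∀ (s r : ℕ → ℝ) (n m : ℕ → ℕ), (∀ᶠ k in atTop, 0 < s k) →
      (∀ᶠ k in atTop, 0 < n k) → Tendsto s atTop (𝓝 0) →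
      Tendsto (fun k => n k * s k) atTop (𝓝 t) → (∀ᶠ k in atTop, 0 < r k) →
      (∀ᶠ k in atTop, 0 < m k) → Tendsto r atTop (𝓝 0) →
      Tendsto (fun k => m k * r k) atTop (𝓝 t) → ∀ f, ∀ ε > 0, ∃ N, ∀ k ≥ N, ∀ l ≥ N,
      ‖(R (s k) ^ n k) f - (R (r l) ^ m l) f‖ < ε := by
    intro t ht s r n m hs hn hs0 hns hr hm hr0 hmr f ε hε
    obtain ⟨δ, hδ, h⟩ := hR.exists_pos_norm_pow_sub_pow_lt hΓ f ht hε
    have h1 := hs0.eventually (gt_mem_nhds hδ)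
    have h2 := hr0.eventually (gt_mem_nhds hδ)
    have h3 := Metric.tendsto_nhds.1 hns δ hδ
    have h4 := Metric.tendsto_nhds.1 hmr δ hδ
    obtain ⟨N, hN⟩ := eventually_atTop.1
      (h1.and (h2.and (h3.and (h4.and (hs.and (hr.and (hn.and hm)))))))
    refine ⟨N, fun k hk l hl => ?_⟩
    obtain ⟨a1, -, a3, -, a5, -, a7, -⟩ := hN k hk
    obtain ⟨-, b2, -, b4, -, b6, -, b8⟩ := hN l hl
    exact h _ _ _ _ a5 a1 b6 b2 a7 b8 a3 b4
  have hbase : ∀ t : ℝ, 0 < t → (∀ᶠ k : ℕ in atTop, 0 < t / k) ∧ (∀ᶠ k : ℕ in atTop, 0 < k) ∧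
      Tendsto (fun k : ℕ => t / (k : ℝ)) atTop (𝓝 0) ∧
      Tendsto (fun k : ℕ => (k : ℝ) * (t / k)) atTop (𝓝 t) := by
    intro t ht
    refine ⟨?_, eventually_gt_atTop 0, tendsto_const_div_atTop_nhds_zero_nat t, ?_⟩
    · filter_upwards [eventually_gt_atTop 0] with k hk
      exact div_pos ht (Nat.cast_pos.2 hk)
    · refine tendsto_const_nhds.congr' ?_
      filter_upwards [eventually_gt_atTop 0] with k hk
      rw [mul_div_cancel₀]
      exact (Nat.cast_pos.2 hk).ne'
  have hlim : ∀ t > 0, ∀ f, ∃ x, Tendsto (fun k : ℕ => (R (t / k) ^ k) f) atTop (𝓝 x) := by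
    intro t ht f
    obtain ⟨h1, h2, h3, h4⟩ := hbase t ht
    refine cauchySeq_tendsto_of_complete (Metric.cauchySeq_iff.2 fun ε hε => ?_)
    obtain ⟨N, hN⟩ := key t ht _ _ _ _ h1 h2 h3 h4 h1 h2 h3 h4 f ε hε
    exact ⟨N, fun k hk l hl => by rw [dist_eq_norm]; exact hN k hk l hl⟩
  have : ∀ t f, ∃ x, 0 < t → Tendsto (fun k : ℕ => (R (t / k) ^ k) f) atTop (𝓝 x) := by
    intro t f
    by_cases ht : 0 < t
    · obtain ⟨x, hx⟩ := hlim t ht f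
      exact ⟨x, fun _ => hx⟩
    · exact ⟨0, fun h => absurd h ht⟩
  choose P hP using this
  refine ⟨P, fun t ht s n hs hn hs0 hns f => ?_⟩
  obtain ⟨h1, h2, h3, h4⟩ := hbase t ht
  refine (tendsto_iff_of_dist ?_).1 (hP t f ht)
  refine Metric.tendsto_nhds.2 fun ε hε => ?_
  obtain ⟨N, hN⟩ := key t ht _ _ _ _ h1 h2 h3 h4 hs hn hs0 hns f ε hε
  filter_upwards [eventually_ge_atTop N] with k hk
  rw [Real.dist_eq, sub_zero, abs_of_nonneg dist_nonneg, dist_eq_norm]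
  exact hN k hk k hk

end IsResolventFamily

/-! ### Properties of the semigroup inherited from resolvent powers. -/

namespace IsSemigroupLimit

variable {P : ℝ → E → E}

theorem tendsto_div (hP : IsSemigroupLimit R P) {t : ℝ} (ht : 0 < t) (f : E) :
    Tendsto (fun k : ℕ => (R (t / k) ^ k) f) atTop (𝓝 (P t f)) := by
  refine hP t ht _ _ ?_ (eventually_gt_atTop 0) (tendsto_const_div_atTop_nhds_zero_nat t) ?_ f
  · filter_upwards [eventually_gt_atTop 0] with k hk
    exact div_pos ht (Nat.cast_pos.2 hk)
  · refine tendsto_const_nhds.congr' ?_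
    filter_upwards [eventually_gt_atTop 0] with k hk
    rw [mul_div_cancel₀]
    exact (Nat.cast_pos.2 hk).ne'

theorem tendsto_ceil (hP : IsSemigroupLimit R P) {s : ℕ → ℝ} (hs : ∀ᶠ k in atTop, 0 < s k)
    (hs0 : Tendsto s atTop (𝓝 0)) {t : ℝ} (ht : 0 < t) (f : E) :
    Tendsto (fun k : ℕ => (R (s k) ^ ⌈t / s k⌉₊) f) atTop (𝓝 (P t f)) := by
  refine hP t ht _ _ hs ?_ hs0 ?_ f
  · filter_upwards [hs] with k hk
    exact Nat.ceil_pos.2 (div_pos ht hk)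
  · refine tendsto_of_tendsto_of_tendsto_of_le_of_le' tendsto_const_nhds
      (by simpa using tendsto_const_nhds.add hs0 : Tendsto (fun k => t + s k) atTop (𝓝 t)) ?_ ?_
    · filter_upwards [hs] with k hk
      have := Nat.le_ceil (t / s k)
      rwa [div_le_iff₀ hk] at this
    · filter_upwards [hs] with k hk
      have := (Nat.ceil_lt_add_one (div_pos ht hk).le).le
      have h2 := mul_le_mul_of_nonneg_right this hk.le
      rwa [add_mul, div_mul_cancel₀ _ hk.ne', one_mul] at h2

theorem norm_le (hP : IsSemigroupLimit R P) (hR : IsResolventFamily Γ R)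
    (hΓ : IsNonnegSelfAdjointGraph Γ) {t : ℝ} (ht : 0 < t) (f : E) : ‖P t f‖ ≤ ‖f‖ := by
  refine le_of_tendsto (hP.tendsto_div ht f).norm ?_
  filter_upwards [eventually_gt_atTop 0] with k hk
  exact hR.norm_pow_apply_le hΓ (div_pos ht (Nat.cast_pos.2 hk)) k f

theorem map_add_smul (hP : IsSemigroupLimit R P) {t : ℝ} (ht : 0 < t) (c : ℝ) (f g : E) :
    P t (f + c • g) = P t f + c • P t g := by
  refine tendsto_nhds_unique (hP.tendsto_div ht _) ?_
  simp only [map_add, map_smul]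
  exact (hP.tendsto_div ht f).add ((hP.tendsto_div ht g).const_smul c)

theorem inner_comm (hP : IsSemigroupLimit R P) (hR : IsResolventFamily Γ R)
    (hΓ : IsNonnegSelfAdjointGraph Γ) {t : ℝ} (ht : 0 < t) (f g : E) :
    inner ℝ (P t f) g = inner ℝ f (P t g) := by
  refine tendsto_nhds_unique ((hP.tendsto_div ht f).inner tendsto_const_nhds) ?_
  refine (tendsto_const_nhds.inner (hP.tendsto_div ht g)).congr' ?_
  filter_upwards [eventually_gt_atTop 0] with k hk
  exact (hR.inner_pow_apply hΓ (div_pos ht (Nat.cast_pos.2 hk)) k f g).symm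

theorem inner_self_nonneg (hP : IsSemigroupLimit R P) (hR : IsResolventFamily Γ R)
    (hΓ : IsNonnegSelfAdjointGraph Γ) {t : ℝ} (ht : 0 < t) (f : E) : 0 ≤ inner ℝ (P t f) f := by
  refine ge_of_tendsto ((hP.tendsto_div ht f).inner tendsto_const_nhds) ?_
  filter_upwards [eventually_gt_atTop 0] with k hk
  exact hR.inner_pow_apply_self_nonneg hΓ (div_pos ht (Nat.cast_pos.2 hk)) k f

theorem norm_sq_eq (hP : IsSemigroupLimit R P) (hR : IsResolventFamily Γ R)
    (hΓ : IsNonnegSelfAdjointGraph Γ) {t : ℝ} (ht : 0 < t) (f : E) :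
    ‖P t f‖ ^ 2 = inner ℝ (P (2 * t) f) f := by
  refine tendsto_nhds_unique ((hP.tendsto_div ht f).norm.pow 2) ?_
  have h1 : Tendsto (fun k : ℕ => (R (t / k) ^ (k + k)) f) atTop (𝓝 (P (2 * t) f)) := by
    refine hP (2 * t) (by positivity) _ _ ?_ ?_ (tendsto_const_div_atTop_nhds_zero_nat t) ?_ f
    · filter_upwards [eventually_gt_atTop 0] with k hk
      exact div_pos ht (Nat.cast_pos.2 hk)
    · filter_upwards [eventually_gt_atTop 0] with k hk
      omega
    · refine tendsto_const_nhds.congr' ?_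
      filter_upwards [eventually_gt_atTop 0] with k hk
      have : (k : ℝ) ≠ 0 := (Nat.cast_pos.2 hk).ne'
      push_cast
      field_simp
      ring
  refine (h1.inner tendsto_const_nhds).congr' ?_
  filter_upwards [eventually_gt_atTop 0] with k hk
  rw [pow_add, mul_apply_eq_comp, hR.inner_pow_apply hΓ (div_pos ht (Nat.cast_pos.2 hk)),
    real_inner_self_eq_norm_sq]

/-- Cauchy-Schwarz for the nonnegative form ⟨P_t f, g⟩, in the weighted additive shape that can be
integrated in t. -/
theorem two_mul_abs_inner_le (hP : IsSemigroupLimit R P) (hR : IsResolventFamily Γ R)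
    (hΓ : IsNonnegSelfAdjointGraph Γ) {t : ℝ} (ht : 0 < t) (f g : E) {c : ℝ} (hc : 0 < c) :
    2 * |inner ℝ (P t f) g| ≤ c⁻¹ * inner ℝ (P t f) f + c * inner ℝ (P t g) g := by
  have key : ∀ c : ℝ, 0 ≤ inner ℝ (P t f) f + 2 * c * inner ℝ (P t f) g
      + c ^ 2 * inner ℝ (P t g) g := by
    intro c
    have h1 := hP.inner_self_nonneg hR hΓ ht (f + c • g)
    rw [hP.map_add_smul ht] at h1
    simp only [inner_add_left, inner_add_right, inner_smul_left, inner_smul_right,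
      RCLike.conj_to_real] at h1
    rw [hP.inner_comm hR hΓ ht g f, real_inner_comm (P t f) g] at h1
    linarith
  have h1 := mul_le_mul_of_nonneg_left (key c) (inv_pos.2 hc).le
  have h2 := mul_le_mul_of_nonneg_left (key (-c)) (inv_pos.2 hc).le
  have e1 : c⁻¹ * (inner ℝ (P t f) f + 2 * c * inner ℝ (P t f) g + c ^ 2 * inner ℝ (P t g) g)
      = c⁻¹ * inner ℝ (P t f) f + 2 * inner ℝ (P t f) g + c * inner ℝ (P t g) g := by
    field_simp
  have e2 : c⁻¹ * (inner ℝ (P t f) f + 2 * -c * inner ℝ (P t f) g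
      + (-c) ^ 2 * inner ℝ (P t g) g)
      = c⁻¹ * inner ℝ (P t f) f - 2 * inner ℝ (P t f) g + c * inner ℝ (P t g) g := by
    field_simp
    ring
  rw [e1, mul_zero] at h1
  rw [e2, mul_zero] at h2
  rcases abs_cases (inner ℝ (P t f) g) with ⟨h, -⟩ | ⟨h, -⟩ <;> rw [h] <;> linarith

theorem aestronglyMeasurable_inner (hP : IsSemigroupLimit R P) (f g : E) :
    AEStronglyMeasurable (fun t => inner ℝ (P t f) g) (volume.restrict (Set.Ioi 0)) := by
  have hs : ∀ᶠ k : ℕ in atTop, (0 : ℝ) < 1 / ((k : ℝ) + 1) :=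
    Eventually.of_forall fun k => Nat.one_div_pos_of_nat
  refine aestronglyMeasurable_of_tendsto_ae (u := atTop)
    (f := fun k : ℕ => fun t : ℝ =>
      inner ℝ ((R (1 / ((k : ℝ) + 1)) ^ ⌈t / (1 / ((k : ℝ) + 1))⌉₊) f) g) ?_ ?_
  · intro k
    refine Measurable.aestronglyMeasurable ?_
    exact (measurable_from_top (f := fun n : ℕ =>
      (inner ℝ ((R (1 / ((k : ℝ) + 1)) ^ n) f) g : ℝ))).comp
      (Nat.measurable_ceil.comp (measurable_id.div_const _))
  · refine (ae_restrict_iff' measurableSet_Ioi).2 (Eventually.of_forall fun t ht => ?_)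
    exact (hP.tendsto_ceil hs tendsto_one_div_add_atTop_nhds_zero_nat ht f).inner
      tendsto_const_nhds

theorem abs_inner_le (hP : IsSemigroupLimit R P) (hR : IsResolventFamily Γ R)
    (hΓ : IsNonnegSelfAdjointGraph Γ) {t : ℝ} (ht : 0 < t) (f g : E) :
    |inner ℝ (P t f) g| ≤ ‖f‖ * ‖g‖ :=
  (abs_real_inner_le_norm _ _).trans
    (mul_le_mul_of_nonneg_right (hP.norm_le hR hΓ ht f) (norm_nonneg g))

/-! ### Integrals of the semigroup -/

theorem _root_.integral_ceil_div {σ : ℝ} (hσ : 0 < σ) (a : ℕ → ℝ) (n : ℕ) :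
    ∫ t in (0 : ℝ)..(n * σ), a ⌈t / σ⌉₊ = σ * ∑ k ∈ Finset.range n, a (k + 1) := by
  have hceil : ∀ (k : ℕ) (t : ℝ), t ∈ Set.uIoc (k * σ) ((k + 1 : ℕ) * σ) →
      a ⌈t / σ⌉₊ = a (k + 1) := by
    intro k t ht
    rw [Set.uIoc_of_le (by push_cast; nlinarith)] at ht
    congr 1
    rw [Nat.ceil_eq_iff (Nat.succ_ne_zero k)]
    refine ⟨?_, (div_le_iff₀ hσ).2 ht.2⟩
    rw [Nat.succ_sub_one]
    exact (lt_div_iff₀ hσ).2 ht.1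
  have hint : ∀ k < n, IntervalIntegrable (fun t : ℝ => a ⌈t / σ⌉₊) volume
      (((k : ℕ) : ℝ) * σ) (((k + 1 : ℕ) : ℝ) * σ) := by
    intro k _
    refine (intervalIntegrable_const (c := a (k + 1))).congr ?_
    exact fun t ht => (hceil k t ht).symm
  have h := intervalIntegral.sum_integral_adjacent_intervals
    (a := fun k : ℕ => (k : ℝ) * σ) hint
  simp only [Nat.cast_zero, zero_mul] at h
  rw [← h, Finset.mul_sum]
  refine Finset.sum_congr rfl fun k _ => ?_
  rw [intervalIntegral.integral_congr_ae (g := fun _ => a (k + 1))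
    (Eventually.of_forall fun t ht => hceil k t ht), intervalIntegral.integral_const]
  push_cast
  rw [smul_eq_mul]
  ring

/-- With step T/n, the approximation by ceilings is a step function of t whose integral is this sum;
contractivity gives the dominating constant. -/
theorem tendsto_sum_inner (hP : IsSemigroupLimit R P) (hR : IsResolventFamily Γ R)
    (hΓ : IsNonnegSelfAdjointGraph Γ) {T : ℝ} (hT : 0 < T) (f g : E) :
    Tendsto (fun n : ℕ => T / n * ∑ k ∈ Finset.range n, inner ℝ ((R (T / n) ^ (k + 1)) f) g)
      atTop (𝓝 (∫ t in (0 : ℝ)..T, inner ℝ (P t f) g)) := by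
  have hpos : ∀ᶠ n : ℕ in atTop, 0 < T / n := by
    filter_upwards [eventually_gt_atTop 0] with k hk
    exact div_pos hT (Nat.cast_pos.2 hk)
  have h1 : Tendsto (fun n : ℕ => ∫ t in (0 : ℝ)..T, inner ℝ ((R (T / n) ^ ⌈t / (T / n)⌉₊) f) g)
      atTop (𝓝 (∫ t in (0 : ℝ)..T, inner ℝ (P t f) g)) := by
    refine intervalIntegral.tendsto_integral_filter_of_dominated_convergence
      (fun _ => ‖f‖ * ‖g‖) ?_ ?_ intervalIntegrable_const ?_
    · refine Eventually.of_forall fun n => Measurable.aestronglyMeasurable ?_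
      exact (measurable_from_top (f := fun k : ℕ =>
        (inner ℝ ((R (T / n) ^ k) f) g : ℝ))).comp
        (Nat.measurable_ceil.comp (measurable_id.div_const _))
    · filter_upwards [hpos] with n hn
      refine Eventually.of_forall fun t _ => (abs_real_inner_le_norm _ _).trans ?_
      exact mul_le_mul_of_nonneg_right (hR.norm_pow_apply_le hΓ hn _ f) (norm_nonneg g)
    · refine Eventually.of_forall fun t ht => ?_
      rw [Set.uIoc_of_le hT.le] at ht
      exact (hP.tendsto_ceil hpos (tendsto_const_div_atTop_nhds_zero_nat T) ht.1 f).inner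
        tendsto_const_nhds
  refine h1.congr' ?_
  filter_upwards [hpos, eventually_gt_atTop 0] with n hn hn0
  have h2 := integral_ceil_div hn (fun k => inner ℝ ((R (T / n) ^ k) f) g) n
  rwa [mul_div_cancel₀ _ (Nat.cast_pos.2 hn0).ne'] at h2

end IsSemigroupLimit

/-- Telescoping; the discrete form of A ∫₀ᵀ P_t f dt = f - P_T f. -/
theorem IsResolventFamily.sum_mem (hR : IsResolventFamily Γ R) {s : ℝ} (hs : 0 < s) (f : E)
    (n : ℕ) : (s • ∑ k ∈ Finset.range n, (R s ^ (k + 1)) f, f - (R s ^ n) f) ∈ Γ := by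
  induction n with
  | zero =>
    convert Γ.zero_mem using 1
    simp
  | succ n ih =>
    have h1 := Γ.smul_mem s (hR s hs ((R s ^ n) f))
    have h2 := Γ.add_mem ih h1
    rw [Prod.smul_mk, Prod.mk_add_mk, smul_smul, mul_inv_cancel₀ hs.ne', one_smul,
      ← mul_apply_eq_comp, ← pow_succ'] at h2
    rw [Finset.sum_range_succ, smul_add]
    convert h2 using 2
    abel

theorem IsResolventFamily.inner_pow_sum_nonneg (hR : IsResolventFamily Γ R)
    (hΓ : IsNonnegSelfAdjointGraph Γ) {s : ℝ} (hs : 0 < s) (f : E) (n : ℕ) :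
    0 ≤ inner ℝ ((R s ^ n) f) (s • ∑ k ∈ Finset.range n, (R s ^ (k + 1)) f) := by
  rw [inner_smul_right, inner_sum]
  refine mul_nonneg hs.le (Finset.sum_nonneg fun k _ => ?_)
  rw [← hR.inner_pow_apply hΓ hs, ← mul_apply_eq_comp, ← pow_add]
  exact hR.inner_pow_apply_self_nonneg hΓ hs _ f

namespace IsSemigroupLimit

variable {P : ℝ → E → E}

/-- For the discrete potential F, the hypothesis gives ⟨F,f⟩² ≤ C⟨f - R_s^n f, F⟩ ≤ C⟨F,f⟩, hence
⟨F,f⟩ ≤ C. -/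
theorem integral_le (hP : IsSemigroupLimit R P) (hR : IsResolventFamily Γ R)
    (hΓ : IsNonnegSelfAdjointGraph Γ) {f : E} {C : ℝ} (hC : 0 ≤ C)
    (h : ∀ p ∈ Γ, inner ℝ p.1 f ^ 2 ≤ C * inner ℝ p.2 p.1) {T : ℝ} (hT : 0 < T) :
    ∫ t in (0 : ℝ)..T, inner ℝ (P t f) f ≤ C := by
  refine le_of_tendsto (hP.tendsto_sum_inner hR hΓ hT f f) ?_
  filter_upwards [eventually_gt_atTop 0] with n hn
  have hs : 0 < T / n := div_pos hT (Nat.cast_pos.2 hn)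
  set s := T / n with hsdef
  have hmem := hR.sum_mem hs f n
  set F := s • ∑ k ∈ Finset.range n, (R s ^ (k + 1)) f with hF
  have h1 : inner ℝ F f ^ 2 ≤ C * inner ℝ (f - (R s ^ n) f) F := h _ hmem
  have hFf : s * ∑ k ∈ Finset.range n, inner ℝ ((R s ^ (k + 1)) f) f = inner ℝ F f := by
    rw [hF, inner_smul_left, sum_inner]
    rfl
  rw [hFf]
  have h2 := hR.inner_pow_sum_nonneg hΓ hs f n
  rw [← hF] at h2
  rw [inner_sub_left, real_inner_comm F f] at h1
  have h3 : C * (inner ℝ F f - inner ℝ ((R s ^ n) f) F) ≤ C * inner ℝ F f :=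
    mul_le_mul_of_nonneg_left (by linarith) hC
  by_contra! hlt
  nlinarith [hC.trans_lt hlt]

theorem integrableOn_inner (hP : IsSemigroupLimit R P) (hR : IsResolventFamily Γ R)
    (hΓ : IsNonnegSelfAdjointGraph Γ) (f g : E) (T : ℝ) :
    IntegrableOn (fun t => inner ℝ (P t f) g) (Set.Ioc 0 T) := by
  refine IntegrableOn.of_bound (C := ‖f‖ * ‖g‖) (by simp)
    ((hP.aestronglyMeasurable_inner f g).mono_set Set.Ioc_subset_Ioi_self) ?_
  exact (ae_restrict_iff' measurableSet_Ioc).2 (Eventually.of_forall fun t ht =>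
    hP.abs_inner_le hR hΓ ht.1 f g)

/-- ⟨P_t f, f⟩ = ‖P_{t/2} f‖², and a positive lower bound for it would make the integrals exceed C.
-/
theorem exists_norm_lt (hP : IsSemigroupLimit R P) (hR : IsResolventFamily Γ R)
    (hΓ : IsNonnegSelfAdjointGraph Γ) {f : E} {C : ℝ}
    (hI : ∀ T > 0, ∫ t in (0 : ℝ)..T, inner ℝ (P t f) f ≤ C) {ε : ℝ} (hε : 0 < ε) :
    ∃ T > 0, ‖P T f‖ < ε := by
  by_contra! hcon
  have h1 : ∀ t > 0, ε ^ 2 ≤ inner ℝ (P t f) f := by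
    intro t ht
    have h2 := pow_le_pow_left₀ hε.le (hcon (t / 2) (half_pos ht)) 2
    rwa [hP.norm_sq_eq hR hΓ (half_pos ht), mul_div_cancel₀ _ two_ne_zero] at h2
  have hT : 0 < (|C| + 1) / ε ^ 2 := by positivity
  have h3 := hI _ hT
  rw [intervalIntegral.integral_of_le hT.le] at h3
  have h4 : ∫ _ in Set.Ioc (0 : ℝ) ((|C| + 1) / ε ^ 2), ε ^ 2 ≤
      ∫ t in Set.Ioc (0 : ℝ) ((|C| + 1) / ε ^ 2), inner ℝ (P t f) f :=
    setIntegral_mono_on (integrableOn_const (by simp)) (hP.integrableOn_inner hR hΓ f f _)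
      measurableSet_Ioc fun t ht => h1 t ht.1
  rw [setIntegral_const, Real.volume_real_Ioc_of_le hT.le, sub_zero, smul_eq_mul,
    div_mul_cancel₀ _ (by positivity)] at h4
  linarith [le_abs_self C]

/-- Converse of `integral_le`, with B in the role of h(φ). The hypothesis applied to F and f - R_s^n
f bounds ⟨f - P_T f, φ⟩² by C B in the limit; then T is chosen with P_T f small. -/
theorem inner_sq_le (hP : IsSemigroupLimit R P) (hR : IsResolventFamily Γ R)
    (hΓ : IsNonnegSelfAdjointGraph Γ) {f φ : E} {C B : ℝ}
    (hI : ∀ T > 0, ∫ t in (0 : ℝ)..T, inner ℝ (P t f) f ≤ C) (hB : 0 ≤ B)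
    (h : ∀ p ∈ Γ, inner ℝ p.2 φ ^ 2 ≤ inner ℝ p.2 p.1 * B) :
    inner ℝ f φ ^ 2 ≤ C * B := by
  have key : ∀ T > 0, (inner ℝ f φ - inner ℝ (P T f) φ) ^ 2 ≤ C * B := by
    intro T hT
    refine le_trans ?_ (mul_le_mul_of_nonneg_right (hI T hT) hB)
    refine le_of_tendsto_of_tendsto
      ((tendsto_const_nhds.sub ((hP.tendsto_div hT f).inner tendsto_const_nhds)).pow 2)
      ((hP.tendsto_sum_inner hR hΓ hT f f).mul_const B) ?_
    filter_upwards [eventually_gt_atTop 0] with n hn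
    have hs : 0 < T / n := div_pos hT (Nat.cast_pos.2 hn)
    set s := T / n with hsdef
    have h1 := h _ (hR.sum_mem hs f n)
    have h2 := hR.inner_pow_sum_nonneg hΓ hs f n
    set F := s • ∑ k ∈ Finset.range n, (R s ^ (k + 1)) f with hF
    have hFf : s * ∑ k ∈ Finset.range n, inner ℝ ((R s ^ (k + 1)) f) f = inner ℝ F f := by
      rw [hF, inner_smul_left, sum_inner]
      rfl
    rw [hFf, ← inner_sub_left]
    refine h1.trans (mul_le_mul_of_nonneg_right ?_ hB)
    rw [inner_sub_left, real_inner_comm F f]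
    linarith
  have hCB : 0 ≤ C * B := (sq_nonneg _).trans (key 1 one_pos)
  have habs : |inner ℝ f φ| ≤ √(C * B) := by
    refine le_of_forall_pos_le_add fun ε hε => ?_
    obtain ⟨T, hT, hPT⟩ := hP.exists_norm_lt hR hΓ hI (div_pos hε (by positivity : 0 < ‖φ‖ + 1))
    have h1 := Real.abs_le_sqrt (key T hT)
    have h2 := abs_real_inner_le_norm (P T f) φ
    have h3 : ‖P T f‖ * ‖φ‖ ≤ ε := by
      rw [lt_div_iff₀ (by positivity)] at hPT
      nlinarith [norm_nonneg (P T f)]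
    have h4 := abs_sub_abs_le_abs_sub (inner ℝ f φ) (inner ℝ (P T f) φ)
    linarith
  rw [← sq_abs, ← Real.sq_sqrt hCB]
  exact pow_le_pow_left₀ (abs_nonneg _) habs 2

end IsSemigroupLimit

end Semigroup

namespace WeightedGraph

variable {X : Type*} {b : WeightedGraph X} {q : X → ℝ}

/-! ### The operator `H^{(1)}` -/

variable (X) in
/-- `toL2` as a linear map. -/
def toL2Linear : (X →₀ ℝ) →ₗ[ℝ] L2 X where
  toFun := toL2
  map_add' _ _ := rfl
  map_smul' _ _ := rfl

theorem toL2_sub (φ ψ : X →₀ ℝ) : toL2 (φ - ψ) = toL2 φ - toL2 ψ := rfl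

theorem toL2_smul (c : ℝ) (φ : X →₀ ℝ) : toL2 (c • φ) = c • toL2 φ := rfl

theorem toL2_apply (φ : X →₀ ℝ) (x : X) : toL2 φ x = φ x := rfl

theorem inner_toL2_single (f : L2 X) (x : X) : inner ℝ f (toL2 (Finsupp.single x 1)) = f x := by
  rw [lp.inner_eq_tsum, tsum_eq_single x]
  · simp [toL2_apply]
  · intro y hy
    simp [toL2_apply, Finsupp.single_eq_of_ne hy]

theorem norm_toL2_single (x : X) : ‖toL2 (Finsupp.single x (1 : ℝ))‖ = 1 := by
  have h := inner_toL2_single (toL2 (Finsupp.single x (1 : ℝ))) x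
  rw [real_inner_self_eq_norm_sq, toL2_apply, Finsupp.single_eq_same] at h
  nlinarith [norm_nonneg (toL2 (Finsupp.single x (1 : ℝ)))]

theorem abs_apply_le_norm (f : L2 X) (x : X) : |f x| ≤ ‖f‖ := by
  rw [← inner_toL2_single f x]
  simpa [norm_toL2_single] using abs_real_inner_le_norm f (toL2 (Finsupp.single x 1))

theorem exists_abs_opAt_le (x : X) :
    ∃ M : ℝ, ∀ ψ : X →₀ ℝ, |b.opAt q x ψ| ≤ M * ‖toL2 ψ‖ := by
  refine ⟨|b.diagCoeff q x| + ∑' y, b.weight x y, fun ψ => ?_⟩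
  rw [opAt_eq_tsum, add_mul]
  refine (abs_sub _ _).trans (add_le_add ?_ ?_)
  · rw [abs_mul]
    exact mul_le_mul_of_nonneg_left (abs_apply_le_norm (toL2 ψ) x) (abs_nonneg _)
  · rw [← tsum_mul_right, ← Real.norm_eq_abs]
    refine tsum_of_norm_bounded ((b.summable x).mul_right _).hasSum fun y => ?_
    rw [norm_mul, Real.norm_eq_abs, Real.norm_eq_abs, abs_of_nonneg (b.nonneg x y)]
    exact mul_le_mul_of_nonneg_left (abs_apply_le_norm (toL2 ψ) y) (b.nonneg x y)

/-- With φ fixed, only finitely many rows of b enter, and each is summable. The resulting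
ℓ²-continuity of h(φ,·) is what makes h closable. -/
theorem exists_abs_formBilin_le (φ : X →₀ ℝ) :
    ∃ M : ℝ, ∀ ψ : X →₀ ℝ, |b.formBilin q φ ψ| ≤ M * ‖toL2 ψ‖ := by
  choose M hM using fun x => exists_abs_opAt_le (b := b) (q := q) x
  refine ⟨∑ x ∈ φ.support, |φ x| * M x, fun ψ => ?_⟩
  rw [b.formBilin_apply q φ ψ φ.support subset_rfl, Finset.sum_mul]
  refine (Finset.abs_sum_le_sum_abs _ _).trans (Finset.sum_le_sum fun x _ => ?_)
  rw [abs_mul, mul_assoc]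
  exact mul_le_mul_of_nonneg_left (hM x ψ) (abs_nonneg _)

/-! ### Closability of the form in ℓ²(X). -/

namespace IsFormApprox

variable {φ φ' ψ ψ' : ℕ → X →₀ ℝ} {f g : L2 X}

theorem cauchy (h : b.IsFormApprox q φ f) {ε : ℝ} (hε : 0 < ε) :
    ∃ N, ∀ m ≥ N, ∀ n ≥ N, b.formBilin q (φ m - φ n) (φ m - φ n) < ε := by
  simpa only [form_eq_formBilin] using h.1 ε hε

theorem add_smul (hq : b.FormNonneg q) (h : b.IsFormApprox q φ f) (h' : b.IsFormApprox q ψ g)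
    (c : ℝ) : b.IsFormApprox q (fun n => φ n + c • ψ n) (f + c • g) := by
  refine ⟨fun ε hε => ?_, ?_⟩
  · obtain ⟨N₁, h1⟩ := h.cauchy (ε := ε / 4) (by positivity)
    obtain ⟨N₂, h2⟩ := h'.cauchy (ε := ε / (4 * (c ^ 2 + 1))) (by positivity)
    refine ⟨max N₁ N₂, fun m hm n hn => ?_⟩
    have h3 := h1 m (le_of_max_le_left hm) n (le_of_max_le_left hn)
    have h4 := h2 m (le_of_max_le_right hm) n (le_of_max_le_right hn)
    have h5 : φ m + c • ψ m - (φ n + c • ψ n) = (φ m - φ n) + c • (ψ m - ψ n) := by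
      rw [smul_sub]
      abel
    rw [form_eq_formBilin, h5]
    refine (bilin_add_le hq.bilin _ _).trans_lt ?_
    rw [lt_div_iff₀ (by positivity)] at h4
    have h6 := hq.bilin (ψ m - ψ n)
    have h7 : b.formBilin q (c • (ψ m - ψ n)) (c • (ψ m - ψ n))
        = c ^ 2 * b.formBilin q (ψ m - ψ n) (ψ m - ψ n) := by
      rw [map_smul, map_smul, LinearMap.smul_apply, smul_eq_mul, smul_eq_mul]
      ring
    rw [h7]
    nlinarith
  · exact h.2.add (h'.2.const_smul c)

theorem sub (hq : b.FormNonneg q) (h : b.IsFormApprox q φ f) (h' : b.IsFormApprox q ψ g) :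
    b.IsFormApprox q (fun n => φ n - ψ n) (f - g) := by
  simpa only [neg_smul, one_smul, ← sub_eq_add_neg] using add_smul hq h h' (-1)

theorem const (φ : X →₀ ℝ) : b.IsFormApprox q (fun _ => φ) (toL2 φ) :=
  ⟨fun ε hε => ⟨0, fun _ _ _ _ => by simpa [form_eq_formBilin] using hε⟩, tendsto_const_nhds⟩

theorem exists_bound (hq : b.FormNonneg q) (h : b.IsFormApprox q φ f) :
    ∃ M, ∀ᶠ n in atTop, b.formBilin q (φ n) (φ n) ≤ M := by
  obtain ⟨N, hN⟩ := h.cauchy one_pos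
  refine ⟨2 * 1 + 2 * b.formBilin q (φ N) (φ N), ?_⟩
  filter_upwards [eventually_ge_atTop N] with n hn
  have h1 := bilin_le_two_mul hq.bilin (φ n) (φ N)
  linarith [hN n hn N le_rfl]

/-- Expanding h(φ_m - φ_n) < ε/2 gives h(φ_n) ≤ ε/2 + 2h(φ_n, φ_m), and the last term vanishes as m
grows with n fixed. -/
theorem tendsto_zero (hq : b.FormNonneg q) (h : b.IsFormApprox q φ 0) :
    Tendsto (fun n => b.formBilin q (φ n) (φ n)) atTop (𝓝 0) := by
  refine Metric.tendsto_nhds.2 fun ε hε => ?_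
  obtain ⟨N, hN⟩ := h.cauchy (half_pos hε)
  filter_upwards [eventually_ge_atTop N] with n hn
  rw [Real.dist_eq, sub_zero, abs_of_nonneg (hq.bilin _)]
  refine lt_of_le_of_lt ?_ (half_lt_self hε)
  obtain ⟨M, hM⟩ := exists_abs_formBilin_le (b := b) (q := q) (φ n)
  have h1 : Tendsto (fun m => b.formBilin q (φ n) (φ m)) atTop (𝓝 0) := by
    have h2 := (h.2.norm).const_mul M
    rw [norm_zero, mul_zero] at h2
    exact squeeze_zero_norm (fun m => hM (φ m)) h2
  have h3 : Tendsto (fun m => ε / 2 + 2 * b.formBilin q (φ n) (φ m)) atTop (𝓝 (ε / 2)) := by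
    simpa using (h1.const_mul 2).const_add (ε / 2)
  refine ge_of_tendsto h3 ?_
  filter_upwards [eventually_ge_atTop N] with m hm
  have h4 := hN m hm n hn
  have h5 := hq.bilin (φ m)
  simp only [map_sub, LinearMap.sub_apply, b.formBilin_comm q (φ m) (φ n)] at h4
  linarith

theorem tendsto_zero_mul (hq : b.FormNonneg q) (h : b.IsFormApprox q φ 0)
    (h' : b.IsFormApprox q ψ g) :
    Tendsto (fun n => b.formBilin q (φ n) (ψ n)) atTop (𝓝 0) := by
  obtain ⟨M, hM⟩ := h'.exists_bound hq
  have h1 : Tendsto (fun n => √(b.formBilin q (φ n) (φ n) * M)) atTop (𝓝 0) := by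
    simpa using ((h.tendsto_zero hq).mul_const M).sqrt
  refine squeeze_zero_norm' ?_ h1
  filter_upwards [hM] with n hn
  exact Real.abs_le_sqrt ((hq.cauchySchwarz _ _).trans
    (mul_le_mul_of_nonneg_left hn (hq.bilin _)))

/-- Changing the approximating sequences alters the values by null sequences, so one pair of
sequences determines the closure. -/
theorem closureEq (hq : b.FormNonneg q) (h : b.IsFormApprox q φ f) (h' : b.IsFormApprox q ψ g)
    {c : ℝ} (hc : Tendsto (fun n => b.formBilin q (φ n) (ψ n)) atTop (𝓝 c)) :
    b.ClosureEq q f g c := by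
  intro φ' ψ' hφ' hψ'
  have h1 := tendsto_zero_mul hq (by simpa using sub hq hφ' h) hψ'
  have h2 := tendsto_zero_mul hq (by simpa using sub hq hψ' h') h
  refine (by simpa using (hc.add h1).add h2 : Tendsto _ _ (𝓝 c)).congr fun n => ?_
  rw [form_eq_formBilin, b.formBilin_comm q (ψ' n) (φ n), b.formBilin_comm q (ψ n) (φ n)]
  ring

end IsFormApprox

theorem mem_operatorGraph_iff (hq : b.FormNonneg q) {u g : L2 X} :
    (u, g) ∈ b.operatorGraph q ↔ ∃ φ, b.IsFormApprox q φ u ∧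
      ∀ ψ v, b.IsFormApprox q ψ v →
        Tendsto (fun n => b.formBilin q (φ n) (ψ n)) atTop (𝓝 (inner ℝ g v)) := by
  constructor
  · rintro ⟨⟨φ, hφ⟩, h⟩
    refine ⟨φ, hφ, fun ψ v hψ => ?_⟩
    simpa only [form_eq_formBilin] using h v ⟨ψ, hψ⟩ φ ψ hφ hψ
  · rintro ⟨φ, hφ, h⟩
    refine ⟨⟨φ, hφ⟩, ?_⟩
    rintro v ⟨ψ, hψ⟩
    exact hφ.closureEq hq hψ (h ψ v hψ)

/-- The graph of `H^{(1)}` as a subspace. -/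
def operatorSubmodule (hq : b.FormNonneg q) : Submodule ℝ (L2 X × L2 X) where
  carrier := b.operatorGraph q
  zero_mem' := by
    refine (mem_operatorGraph_iff hq).2 ⟨fun _ => 0, IsFormApprox.const 0, fun ψ v _ => ?_⟩
    simp
  add_mem' := by
    rintro ⟨u, g⟩ ⟨v, k⟩ hu hv
    obtain ⟨φ, hφ, h1⟩ := (mem_operatorGraph_iff hq).1 hu
    obtain ⟨ψ, hψ, h2⟩ := (mem_operatorGraph_iff hq).1 hv
    refine (mem_operatorGraph_iff hq).2 ⟨_, by simpa using hφ.add_smul hq hψ 1, fun χ w hχ => ?_⟩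
    simpa [inner_add_left] using (h1 χ w hχ).add (h2 χ w hχ)
  smul_mem' := by
    rintro c ⟨u, g⟩ hu
    obtain ⟨φ, hφ, h1⟩ := (mem_operatorGraph_iff hq).1 hu
    have h0 : toL2 (0 : X →₀ ℝ) = 0 := rfl
    refine (mem_operatorGraph_iff hq).2
      ⟨_, by simpa [h0] using (IsFormApprox.const 0).add_smul hq hφ c, fun χ w hχ => ?_⟩
    rw [inner_smul_left]
    simpa [toL2_smul] using (h1 χ w hχ).const_mul c

/-- The bilinear form `s h + ⟨·,·⟩`. -/
def shiftedForm (b : WeightedGraph X) (q : X → ℝ) (s : ℝ) : LinearMap.BilinForm ℝ (X →₀ ℝ) :=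
  s • b.formBilin q + (innerₗ (L2 X)).compl₁₂ (toL2Linear X) (toL2Linear X)

theorem shiftedForm_apply (s : ℝ) (φ ψ : X →₀ ℝ) :
    b.shiftedForm q s φ ψ = s * b.formBilin q φ ψ + inner ℝ (toL2 φ) (toL2 ψ) := rfl

/-- Almost minimisers of s h(φ) + ‖φ‖² - 2⟨f,φ⟩ are Cauchy both in ℓ² and for h. In the limit the
Euler-Lagrange equation reads s h(u,v) + ⟨u,v⟩ = ⟨f,v⟩, so the image of u is (f - u)/s. -/
theorem exists_operatorGraph_add_smul_eq (hq : b.FormNonneg q) {s : ℝ} (hs : 0 < s) (f : L2 X) :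
    ∃ p ∈ b.operatorGraph q, p.1 + s • p.2 = f := by
  have hn : ∀ φ, 0 ≤ b.shiftedForm q s φ φ := fun φ => by
    rw [shiftedForm_apply]
    exact add_nonneg (mul_nonneg hs.le (hq.bilin φ)) real_inner_self_nonneg
  have hsymm : ∀ φ ψ, b.shiftedForm q s φ ψ = b.shiftedForm q s ψ φ := fun φ ψ => by
    rw [shiftedForm_apply, shiftedForm_apply, formBilin_comm, real_inner_comm]
  set ℓ : (X →₀ ℝ) →ₗ[ℝ] ℝ := (innerₗ (L2 X) f).comp (toL2Linear X) with hℓ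
  have hℓa : ∀ φ, ℓ φ = inner ℝ f (toL2 φ) := fun φ => rfl
  obtain ⟨d, hd, happ⟩ := exists_isGLB_quadratic (Q := b.shiftedForm q s) (ℓ := ℓ)
    (C := ‖f‖ ^ 2) hn fun φ => by
      rw [hℓa, shiftedForm_apply, real_inner_self_eq_norm_sq]
      have h1 := abs_real_inner_le_norm f (toL2 φ)
      have h2 := pow_le_pow_left₀ (abs_nonneg _) h1 2
      rw [sq_abs, mul_pow] at h2
      refine h2.trans (mul_le_mul_of_nonneg_left ?_ (sq_nonneg _))
      linarith [mul_nonneg hs.le (hq.bilin φ)]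
  have hpos : ∀ n : ℕ, 0 < 1 / ((n : ℝ) + 1) := fun n => Nat.one_div_pos_of_nat
  choose φ hφ using fun n : ℕ => happ (1 / ((n : ℝ) + 1)) (hpos n)
  have hlim : Tendsto (fun n : ℕ => 1 / ((n : ℝ) + 1)) atTop (𝓝 0) :=
    tendsto_one_div_add_atTop_nhds_zero_nat
  have hc : ∀ ε : ℝ, 0 < ε → ∃ N, ∀ m ≥ N, ∀ n ≥ N,
      b.shiftedForm q s (φ m - φ n) (φ m - φ n) < ε := by
    intro ε hε
    obtain ⟨N, hN⟩ := (hlim.eventually (gt_mem_nhds (by positivity : 0 < ε / 4))).exists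
    refine ⟨N, fun m hm n hn => ?_⟩
    have hm' : 1 / ((m : ℝ) + 1) ≤ 1 / ((N : ℝ) + 1) := Nat.one_div_le_one_div hm
    have hn' : 1 / ((n : ℝ) + 1) ≤ 1 / ((N : ℝ) + 1) := Nat.one_div_le_one_div hn
    have h1 := bilin_sub_le_of_almost_minimal hd ((hφ m).le.trans (add_le_add_right hm' d))
      ((hφ n).le.trans (add_le_add_right hn' d))
    linarith
  have hcauchy : CauchySeq fun n => toL2 (φ n) := by
    refine Metric.cauchySeq_iff.2 fun ε hε => ?_
    obtain ⟨N, hN⟩ := hc (ε ^ 2) (by positivity)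
    refine ⟨N, fun m hm n hn => ?_⟩
    rw [dist_eq_norm, ← toL2_sub]
    refine lt_of_pow_lt_pow_left₀ 2 hε.le ?_
    have h1 := hN m hm n hn
    rw [shiftedForm_apply, real_inner_self_eq_norm_sq] at h1
    linarith [mul_nonneg hs.le (hq.bilin (φ m - φ n))]
  obtain ⟨u, hu⟩ := cauchySeq_tendsto_of_complete hcauchy
  have happrox : b.IsFormApprox q φ u := by
    refine ⟨fun ε hε => ?_, hu⟩
    obtain ⟨N, hN⟩ := hc (s * ε) (by positivity)
    refine ⟨N, fun m hm n hn => ?_⟩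
    have h1 := hN m hm n hn
    rw [shiftedForm_apply] at h1
    rw [form_eq_formBilin]
    refine lt_of_mul_lt_mul_left ?_ hs.le
    have h2 : (0 : ℝ) ≤ inner ℝ (toL2 (φ m - φ n)) (toL2 (φ m - φ n)) := real_inner_self_nonneg
    linarith
  refine ⟨(u, s⁻¹ • (f - u)), (mem_operatorGraph_iff hq).2 ⟨φ, happrox, fun ψ v hψ => ?_⟩, ?_⟩
  · obtain ⟨M, hM⟩ := hψ.exists_bound hq
    have h1 : Tendsto (fun n : ℕ => √(1 / ((n : ℝ) + 1) *
        (s * M + inner ℝ (toL2 (ψ n)) (toL2 (ψ n))))) atTop (𝓝 0) := by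
      simpa using (hlim.mul ((hψ.2.inner (𝕜 := ℝ) hψ.2).const_add (s * M))).sqrt
    have h2 : Tendsto (fun n => b.shiftedForm q s (φ n) (ψ n) - ℓ (ψ n)) atTop (𝓝 0) := by
      refine squeeze_zero_norm' ?_ h1
      filter_upwards [hM] with n hMn
      refine Real.abs_le_sqrt
        ((bilin_sq_le_of_almost_minimal hsymm hd (hφ n).le (ψ n)).trans ?_)
      refine mul_le_mul_of_nonneg_left ?_ (hpos n).le
      rw [shiftedForm_apply]
      linarith [mul_le_mul_of_nonneg_left hMn hs.le]
    have h3 : Tendsto (fun n => inner ℝ f (toL2 (ψ n)) - inner ℝ (toL2 (φ n)) (toL2 (ψ n)))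
        atTop (𝓝 (inner ℝ f v - inner ℝ u v)) :=
      (tendsto_const_nhds.inner hψ.2).sub (hu.inner hψ.2)
    have h4 := (h2.add h3).const_mul s⁻¹
    rw [zero_add] at h4
    rw [inner_smul_left, inner_sub_left]
    refine h4.congr fun n => ?_
    rw [shiftedForm_apply, hℓa]
    field_simp
    ring
  · simp only
    rw [smul_smul, mul_inv_cancel₀ hs.ne', one_smul]
    abel

theorem isNonnegSelfAdjointGraph (hq : b.FormNonneg q) :
    IsNonnegSelfAdjointGraph (operatorSubmodule hq) where
  nonneg := by
    rintro ⟨u, g⟩ hp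
    obtain ⟨φ, hφ, h⟩ := (mem_operatorGraph_iff hq).1 hp
    exact ge_of_tendsto' (h φ u hφ) fun n => hq.bilin _
  symm := by
    rintro ⟨u, g⟩ hp ⟨v, k⟩ hr
    obtain ⟨φ, hφ, h⟩ := (mem_operatorGraph_iff hq).1 hp
    obtain ⟨ψ, hψ, h'⟩ := (mem_operatorGraph_iff hq).1 hr
    have h1 := h' φ u hφ
    simp only [b.formBilin_comm q (ψ _)] at h1
    rw [real_inner_comm] at h1
    exact tendsto_nhds_unique (h ψ v hψ) h1
  exists_add_smul_eq s hs f := exists_operatorGraph_add_smul_eq hq hs f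
  eq_zero := by
    intro g hg
    have h0 : ∀ x, g x = 0 := by
      intro x
      have h1 := hg.2 (toL2 (Finsupp.single x 1)) ⟨_, IsFormApprox.const _⟩ (fun _ => 0)
        (fun _ => Finsupp.single x 1) (IsFormApprox.const 0) (IsFormApprox.const _)
      simp only [form_eq_formBilin, map_zero, LinearMap.zero_apply, inner_toL2_single] at h1
      exact (tendsto_nhds_unique h1 tendsto_const_nhds)
    exact lp.ext (funext h0)

theorem resolventStep_eq (hq : b.FormNonneg q) {R : ℝ → L2 X →L[ℝ] L2 X}
    (hR : IsResolventFamily (operatorSubmodule hq) R) {s : ℝ} (hs : 0 < s) :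
    b.resolventStep q s = R s := by
  funext f
  have hmem := hR s hs f
  have hex : ∃ u g : L2 X, (u, g) ∈ b.operatorGraph q ∧ u + s • g = f :=
    ⟨_, _, hmem, by rw [smul_smul, mul_inv_cancel₀ hs.ne', one_smul, add_sub_cancel]⟩
  rw [resolventStep, dif_pos hex]
  obtain ⟨g, hg, hgf⟩ := hex.choose_spec
  refine (isNonnegSelfAdjointGraph hq).eq_of_add_smul_eq hs (p := (_, g)) hg hmem ?_
  simp only
  rw [hgf, smul_smul, mul_inv_cancel₀ hs.ne', one_smul, add_sub_cancel]

theorem semigroup_eq (hq : b.FormNonneg q) {R : ℝ → L2 X →L[ℝ] L2 X} {P : ℝ → L2 X → L2 X}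
    (hR : IsResolventFamily (operatorSubmodule hq) R) (hP : IsSemigroupLimit R P) {t : ℝ}
    (ht : 0 < t) (f : L2 X) : b.semigroup q t f = P t f := by
  refine Tendsto.limUnder_eq ((hP.tendsto_div ht f).congr' ?_)
  filter_upwards [eventually_gt_atTop 0] with n hn
  rw [resolventStep_eq hq hR (div_pos ht (Nat.cast_pos.2 hn)), pow_apply_eq_iterate]

/-- Cauchy-Schwarz for the closed form, since pairing with p.2 is the form with p.1 in the first
slot. -/
theorem operatorGraph_sq_le (hq : b.FormNonneg q) {p : L2 X × L2 X} (hp : p ∈ b.operatorGraph q)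
    (φ : X →₀ ℝ) : inner ℝ p.2 (toL2 φ) ^ 2 ≤ inner ℝ p.2 p.1 * b.formBilin q φ φ := by
  obtain ⟨χ, hχ, h⟩ := (mem_operatorGraph_iff hq).1 hp
  exact le_of_tendsto_of_tendsto' ((h _ _ (IsFormApprox.const φ)).pow 2)
    ((h _ _ hχ).mul_const _) fun n => hq.cauchySchwarz _ _

theorem operatorGraph_apply_sq_le (hq : b.FormNonneg q) {C : ℝ} {x : X}
    (hC : ∀ φ : X →₀ ℝ, φ x ^ 2 ≤ C * b.formBilin q φ φ) {p : L2 X × L2 X}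
    (hp : p ∈ b.operatorGraph q) : p.1 x ^ 2 ≤ C * inner ℝ p.2 p.1 := by
  obtain ⟨χ, hχ, h⟩ := (mem_operatorGraph_iff hq).1 hp
  refine le_of_tendsto_of_tendsto' ?_ ((h _ _ hχ).const_mul C) fun n => hC (χ n)
  have h1 := (hχ.2.inner (𝕜 := ℝ) (tendsto_const_nhds (x := toL2 (Finsupp.single x (1 : ℝ))))).pow 2
  simpa only [inner_toL2_single, toL2_apply] using h1

end WeightedGraph

namespace WeightedGraph

variable {X : Type*} {b : WeightedGraph X} {q : X → ℝ}

/-! ### The Green function -/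

theorem tendsto_setLIntegral_Ioc (F : ℝ → ℝ≥0∞) :
    Tendsto (fun n : ℕ => ∫⁻ t in Set.Ioc (0 : ℝ) n, F t) atTop
      (𝓝 (∫⁻ t in Set.Ioi (0 : ℝ), F t)) := by
  have h1 : Set.Ioi (0 : ℝ) = ⋃ n : ℕ, Set.Ioc (0 : ℝ) n := by
    ext t
    simp only [Set.mem_Ioi, Set.mem_iUnion, Set.mem_Ioc]
    exact ⟨fun ht => (exists_nat_ge t).imp fun n hn => ⟨ht, hn⟩, fun ⟨n, hn⟩ => hn.1⟩
  have hmono : Monotone fun n : ℕ => Set.Ioc (0 : ℝ) n := fun m n hmn =>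
    Set.Ioc_subset_Ioc_right (Nat.cast_le.2 hmn)
  rw [h1, setLIntegral_iUnion_of_directed _ hmono.directed_le]
  exact tendsto_atTop_iSup fun m n hmn => lintegral_mono_set (hmono hmn)

theorem exists_setLIntegral_Ioi_lt {F : ℝ → ℝ≥0∞} (hF : ∫⁻ t in Set.Ioi (0 : ℝ), F t ≠ ∞)
    {ε : ℝ≥0∞} (hε : ε ≠ 0) :
    ∃ T > 0, ∫⁻ t in Set.Ioi T, F t < ε := by
  have h1 := (tendsto_setLIntegral_Ioc F).add_const ε
  have h2 := h1.eventually (lt_mem_nhds (ENNReal.lt_add_right hF hε))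
  obtain ⟨n, hn, hn0⟩ := (h2.and (eventually_gt_atTop 0)).exists
  refine ⟨n, Nat.cast_pos.2 hn0, ?_⟩
  have h3 : ∫⁻ t in Set.Ioi (0 : ℝ), F t =
      (∫⁻ t in Set.Ioc (0 : ℝ) n, F t) + ∫⁻ t in Set.Ioi (n : ℝ), F t := by
    rw [← lintegral_union measurableSet_Ioi (Set.Ioc_disjoint_Ioi le_rfl),
      Set.Ioc_union_Ioi_eq_Ioi n.cast_nonneg]
  rw [h3] at hn
  exact lt_of_add_lt_add_left hn

variable {R : ℝ → L2 X →L[ℝ] L2 X} {P : ℝ → L2 X → L2 X}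

theorem green_eq (hq : b.FormNonneg q) (hR : IsResolventFamily (operatorSubmodule hq) R)
    (hP : IsSemigroupLimit R P) (x y : X) :
    b.green q x y = ∫⁻ t in Set.Ioi (0 : ℝ), ENNReal.ofReal
      (inner ℝ (P t (toL2 (Finsupp.single x 1))) (toL2 (Finsupp.single y 1))) := by
  refine setLIntegral_congr_fun measurableSet_Ioi fun t ht => ?_
  simp only
  rw [semigroup_eq hq hR hP ht, inner_toL2_single]

theorem ofReal_integral_eq (hq : b.FormNonneg q)
    (hR : IsResolventFamily (operatorSubmodule hq) R) (hP : IsSemigroupLimit R P) (f : L2 X)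
    {T : ℝ} (hT : 0 ≤ T) :
    ENNReal.ofReal (∫ t in (0 : ℝ)..T, inner ℝ (P t f) f) =
      ∫⁻ t in Set.Ioc (0 : ℝ) T, ENNReal.ofReal (inner ℝ (P t f) f) := by
  have hΓ := isNonnegSelfAdjointGraph hq
  rw [intervalIntegral.integral_of_le hT]
  refine ofReal_integral_eq_lintegral_ofReal (hP.integrableOn_inner hR hΓ f f T) ?_
  exact (ae_restrict_iff' measurableSet_Ioc).2 (Eventually.of_forall fun t ht =>
    hP.inner_self_nonneg hR hΓ ht.1 f)

/-- With f = 1_x, `inner_sq_le` and `integral_le` are the two directions. -/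
theorem green_self_le_iff (hq : b.FormNonneg q)
    (hR : IsResolventFamily (operatorSubmodule hq) R) (hP : IsSemigroupLimit R P) (x : X)
    {C : ℝ} (hC : 0 ≤ C) :
    b.green q x x ≤ ENNReal.ofReal C ↔ ∀ φ : X →₀ ℝ, φ x ^ 2 ≤ C * b.formBilin q φ φ := by
  have hΓ := isNonnegSelfAdjointGraph hq
  rw [green_eq hq hR hP]
  constructor
  · intro h φ
    have hI : ∀ T > 0, ∫ t in (0 : ℝ)..T, inner ℝ (P t (toL2 (Finsupp.single x 1)))
        (toL2 (Finsupp.single x 1)) ≤ C := by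
      intro T hT
      rw [← ENNReal.ofReal_le_ofReal_iff hC, ofReal_integral_eq hq hR hP _ hT.le]
      exact (lintegral_mono_set Set.Ioc_subset_Ioi_self).trans h
    have h1 := hP.inner_sq_le hR hΓ (φ := toL2 φ) hI (hq.bilin φ)
      fun p hp => operatorGraph_sq_le hq hp φ
    rwa [real_inner_comm, inner_toL2_single, toL2_apply] at h1
  · intro h
    refine le_of_tendsto (tendsto_setLIntegral_Ioc _) ?_
    filter_upwards [eventually_gt_atTop 0] with n hn
    rw [← ofReal_integral_eq hq hR hP _ n.cast_nonneg]
    refine ENNReal.ofReal_le_ofReal (hP.integral_le hR hΓ hC (fun p hp => ?_)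
      (Nat.cast_pos.2 hn))
    rw [inner_toL2_single]
    exact operatorGraph_apply_sq_le hq h hp

/-- Since `ENNReal.ofReal` truncates negative values, no positivity of ⟨P_t f, g⟩ is needed. -/
theorem setLIntegral_inner_le (hq : b.FormNonneg q)
    (hR : IsResolventFamily (operatorSubmodule hq) R) (hP : IsSemigroupLimit R P) (f g : L2 X)
    {S : Set ℝ} (hS : MeasurableSet S) (hS0 : S ⊆ Set.Ioi 0) {c : ℝ} (hc : 0 < c) :
    ∫⁻ t in S, ENNReal.ofReal (inner ℝ (P t f) g) ≤
      ENNReal.ofReal c⁻¹ * (∫⁻ t in S, ENNReal.ofReal (inner ℝ (P t f) f)) +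
      ENNReal.ofReal c * ∫⁻ t in S, ENNReal.ofReal (inner ℝ (P t g) g) := by
  have hΓ := isNonnegSelfAdjointGraph hq
  rw [← lintegral_const_mul' _ _ ENNReal.ofReal_ne_top,
    ← lintegral_const_mul' _ _ ENNReal.ofReal_ne_top, ← lintegral_add_left']
  · refine setLIntegral_mono' hS fun t ht => ?_
    have ht0 : 0 < t := hS0 ht
    have h1 := hP.two_mul_abs_inner_le hR hΓ ht0 f g hc
    have hf := hP.inner_self_nonneg hR hΓ ht0 f
    have hg := hP.inner_self_nonneg hR hΓ ht0 g
    rw [← ENNReal.ofReal_mul (inv_pos.2 hc).le, ← ENNReal.ofReal_mul hc.le,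
      ← ENNReal.ofReal_add (mul_nonneg (inv_pos.2 hc).le hf) (mul_nonneg hc.le hg)]
    refine ENNReal.ofReal_le_ofReal ?_
    linarith [le_abs_self (inner ℝ (P t f) g), abs_nonneg (inner ℝ (P t f) g)]
  · exact ((hP.aestronglyMeasurable_inner f f).mono_set hS0).aemeasurable.ennreal_ofReal.const_mul _

theorem sum_sq_le_norm_sq (f : L2 X) (S : Finset X) : ∑ y ∈ S, f y ^ 2 ≤ ‖f‖ ^ 2 := by
  have h := lp.sum_rpow_le_norm_rpow (p := 2) (by norm_num) f S
  simpa using h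

/-- The integrals over (0,T] of (P_t f)(y)² have sum over y at most T‖f‖², so they tend to 0 along
y. The inequality p ≤ δ + p²/(4δ) passes from squares to first powers. -/
theorem finite_lt_setLIntegral_Ioc (hq : b.FormNonneg q)
    (hR : IsResolventFamily (operatorSubmodule hq) R) (hP : IsSemigroupLimit R P) (f : L2 X)
    {T ε : ℝ} (hT : 0 < T) (hε : 0 < ε) :
    {y : X | ENNReal.ofReal ε < ∫⁻ t in Set.Ioc (0 : ℝ) T, ENNReal.ofReal
      (inner ℝ (P t f) (toL2 (Finsupp.single y 1)))}.Finite := by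
  have hΓ := isNonnegSelfAdjointGraph hq
  set p : X → ℝ → ℝ := fun y t => inner ℝ (P t f) (toL2 (Finsupp.single y 1)) with hp
  have hint : ∀ y, IntegrableOn (p y) (Set.Ioc 0 T) := fun y =>
    hP.integrableOn_inner hR hΓ f _ T
  have hsq : ∀ y, IntegrableOn (fun t => p y t ^ 2) (Set.Ioc 0 T) := by
    intro y
    refine IntegrableOn.of_bound (C := ‖f‖ ^ 2) (by simp) ((hint y).1.pow 2) ?_
    refine (ae_restrict_iff' measurableSet_Ioc).2 (Eventually.of_forall fun t ht => ?_)
    rw [Real.norm_eq_abs, abs_pow]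
    refine pow_le_pow_left₀ (abs_nonneg _) ?_ 2
    simpa [norm_toL2_single] using hP.abs_inner_le hR hΓ ht.1 f (toL2 (Finsupp.single y 1))
  have hsum : Summable fun y => ∫ t in Set.Ioc (0 : ℝ) T, p y t ^ 2 := by
    refine summable_of_sum_le (c := T * ‖f‖ ^ 2)
      (fun y => integral_nonneg fun t => sq_nonneg _) fun S => ?_
    rw [← integral_finsetSum _ fun y _ => hsq y]
    have h1 : ∫ t in Set.Ioc (0 : ℝ) T, ∑ y ∈ S, p y t ^ 2 ≤
        ∫ _ in Set.Ioc (0 : ℝ) T, ‖f‖ ^ 2 := by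
      refine setIntegral_mono_on (integrable_finsetSum _ fun y _ => hsq y)
        (integrableOn_const (by simp)) measurableSet_Ioc fun t ht => ?_
      simp only [hp, inner_toL2_single]
      exact (sum_sq_le_norm_sq _ S).trans
        (pow_le_pow_left₀ (norm_nonneg _) (hP.norm_le hR hΓ ht.1 f) 2)
    rwa [setIntegral_const, Real.volume_real_Ioc_of_le hT.le, sub_zero, smul_eq_mul] at h1
  -- The constant term then integrates to ε/2, so an integral above ε forces that of the square
  -- above 2δε.
  set δ : ℝ := ε / (2 * T) with hδ
  have hδ0 : 0 < δ := by positivity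
  have hev := hsum.tendsto_cofinite_zero.eventually
    (gt_mem_nhds (by positivity : 0 < 2 * δ * ε))
  refine (eventually_cofinite.1 hev).subset fun y hy => ?_
  simp only [Set.mem_ofPred_eq, not_lt] at hy ⊢
  have h1 : ∫⁻ t in Set.Ioc (0 : ℝ) T, ENNReal.ofReal (p y t) ≤
      ENNReal.ofReal (∫ t in Set.Ioc (0 : ℝ) T, (δ + (4 * δ)⁻¹ * p y t ^ 2)) := by
    rw [ofReal_integral_eq_lintegral_ofReal]
    · refine lintegral_mono fun t => ENNReal.ofReal_le_ofReal ?_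
      have h2 : δ + (4 * δ)⁻¹ * p y t ^ 2 - p y t = (4 * δ)⁻¹ * (p y t - 2 * δ) ^ 2 := by
        field_simp
        ring
      have h3 : 0 ≤ (4 * δ)⁻¹ * (p y t - 2 * δ) ^ 2 := by positivity
      linarith
    · exact (integrableOn_const (by simp)).add ((hsq y).const_mul _)
    · exact Eventually.of_forall fun t => by simp only [Pi.zero_apply]; positivity
  have h2 := (ENNReal.ofReal_lt_ofReal_iff'.1 (hy.trans_le h1)).1
  rw [integral_add (integrable_const _) ((hsq y).const_mul _), setIntegral_const,
    Real.volume_real_Ioc_of_le hT.le, sub_zero, smul_eq_mul, integral_const_mul] at h2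
  have h3 : T * δ = ε / 2 := by
    rw [hδ]
    field_simp
  rw [h3, inv_mul_eq_div] at h2
  have h4 : ε / 2 < (∫ t in Set.Ioc (0 : ℝ) T, p y t ^ 2) / (4 * δ) := by linarith
  rw [lt_div_iff₀ (by positivity)] at h4
  linarith

theorem green_mem_C0 (hq : b.FormNonneg q) (hR : IsResolventFamily (operatorSubmodule hq) R)
    (hP : IsSemigroupLimit R P) {C : ℝ} (hC : 0 < C)
    (h : ∀ x, b.green q x x ≤ ENNReal.ofReal C) (x : X) :
    (∀ y, b.green q x y ≠ ∞) ∧ (fun y => (b.green q x y).toReal) ∈ C0 X := by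
  simp only [green_eq hq hR hP] at h ⊢
  refine ⟨fun y => ?_, fun ε hε => ?_⟩
  · refine ne_top_of_le_ne_top ?_
      (setLIntegral_inner_le hq hR hP _ _ measurableSet_Ioi subset_rfl one_pos)
    refine ENNReal.add_ne_top.2 ⟨ENNReal.mul_ne_top ENNReal.ofReal_ne_top ?_,
      ENNReal.mul_ne_top ENNReal.ofReal_ne_top ?_⟩
    · exact ne_top_of_le_ne_top ENNReal.ofReal_ne_top (h x)
    · exact ne_top_of_le_ne_top ENNReal.ofReal_ne_top (h y)
  · set e : X → L2 X := fun y => toL2 (Finsupp.single y 1) with he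
    -- In the tail G(y,y) contributes at most c C = ε/4 for every y, and T is chosen so that the
    -- part from G(x,x), weighted by 1/c, is also at most ε/4.
    set c : ℝ := ε / (4 * C) with hc
    have hc0 : 0 < c := by positivity
    obtain ⟨T, hT, htail⟩ := exists_setLIntegral_Ioi_lt
      (ne_top_of_le_ne_top ENNReal.ofReal_ne_top (h x))
      (ENNReal.ofReal_pos.2 (by positivity : 0 < c * (ε / 4))).ne'
    have hfin := finite_lt_setLIntegral_Ioc hq hR hP (e x) hT (half_pos hε)
    set G : X → ℝ≥0∞ := fun y => ∫⁻ t in Set.Ioi (0 : ℝ), ENNReal.ofReal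
      (inner ℝ (P t (e x)) (e y)) with hG
    classical
    refine ⟨Finsupp.onFinset hfin.toFinset
      (fun y => if y ∈ hfin.toFinset then (G y).toReal else 0) (fun y hy => ?_), fun y => ?_⟩
    · by_contra hy'
      exact hy (if_neg hy')
    rw [Finsupp.onFinset_apply]
    split_ifs with hy
    · rw [sub_self, abs_zero]
      exact hε.le
    rw [Set.Finite.mem_toFinset, Set.mem_ofPred_eq, not_lt] at hy
    rw [sub_zero, abs_of_nonneg ENNReal.toReal_nonneg]
    refine ENNReal.toReal_le_of_le_ofReal hε.le ?_
    have h1 : ∫⁻ t in Set.Ioi T, ENNReal.ofReal (inner ℝ (P t (e x)) (e y)) ≤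
        ENNReal.ofReal (ε / 2) := by
      refine (setLIntegral_inner_le hq hR hP (e x) (e y) measurableSet_Ioi
        (Set.Ioi_subset_Ioi hT.le) hc0).trans ?_
      have h2 : ∫⁻ t in Set.Ioi T, ENNReal.ofReal (inner ℝ (P t (e y)) (e y)) ≤
          ENNReal.ofReal C :=
        (lintegral_mono_set (Set.Ioi_subset_Ioi hT.le)).trans (h y)
      refine (add_le_add (mul_le_mul_right htail.le _) (mul_le_mul_right h2 _)).trans ?_
      rw [← ENNReal.ofReal_mul (inv_pos.2 hc0).le, ← ENNReal.ofReal_mul hc0.le,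
        ← ENNReal.ofReal_add (by positivity) (by positivity)]
      refine ENNReal.ofReal_le_ofReal (le_of_eq ?_)
      rw [hc]
      field_simp
      norm_num
    have h3 : G y = (∫⁻ t in Set.Ioc (0 : ℝ) T, ENNReal.ofReal (inner ℝ (P t (e x)) (e y))) +
        ∫⁻ t in Set.Ioi T, ENNReal.ofReal (inner ℝ (P t (e x)) (e y)) := by
      rw [← lintegral_union measurableSet_Ioi (Set.Ioc_disjoint_Ioi le_rfl),
        Set.Ioc_union_Ioi_eq_Ioi hT.le]
    change G y ≤ _
    rw [h3, ← add_halves ε, ENNReal.ofReal_add (half_pos hε).le (half_pos hε).le]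
    refine add_le_add hy ?_
    simpa using h1

end WeightedGraph

end

/-! ### The equivalences and the decay of the Green function. -/

theorem mainTheorem5 {X : Type*} [Infinite X] (b : WeightedGraph X) (hb : b.Connected) (o : X)
    (q : X → ℝ) (hq : b.FormNonneg q) :
    List.TFAE [
      b.UniformlySubcritical q,
      ∃ C : ℝ, 0 < C ∧ ∀ φ : X →₀ ℝ, C * WeightedGraph.supNorm φ ^ 2 ≤ b.form q φ φ,
      b.Subcritical q ∧
        ∃ C : ℝ, 0 < C ∧ ∀ φ : X →₀ ℝ, C * WeightedGraph.supNorm φ ^ 2 ≤ b.normAt q o φ ^ 2,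
      ∃ C : ℝ, 0 < C ∧ ∀ x, b.green q x x ≤ ENNReal.ofReal C,
      ∃ C : ℝ, 0 < C ∧ ∀ x, ∃ u : X → ℝ, b.IsPositiveSuperharmonic q u ∧ u x ≤ C ∧
        ∀ y, Finsupp.single x (1 : ℝ) y ≤ b.schrodinger q u y,
      ∃ C : ℝ, 0 < C ∧ ∀ x, ∃ u : X → ℝ, b.IsPositiveSuperharmonic q u ∧ (∀ y, u y ≤ C) ∧
        ∀ y, Finsupp.single x (1 : ℝ) y ≤ b.schrodinger q u y,
      b.Subcritical q ∧ b.extendedSpace q o ⊆ WeightedGraph.C0 X,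
      ∃ C : ℝ, 0 < C ∧ C < ⨅ x, b.cap q x] ∧
    (b.UniformlySubcritical q →
      ∀ x, (∀ y, b.green q x y ≠ ∞) ∧ (fun y => (b.green q x y).toReal) ∈ WeightedGraph.C0 X) := by
  have hΓ := WeightedGraph.isNonnegSelfAdjointGraph hq
  obtain ⟨R, hR⟩ := hΓ.exists_resolventFamily
  obtain ⟨P, hP⟩ := hR.exists_semigroup hΓ
  have hgreen : ∀ C : ℝ, 0 < C → ((∀ x, b.green q x x ≤ ENNReal.ofReal C) ↔
      ∀ (φ : X →₀ ℝ) (x : X), C⁻¹ * φ x ^ 2 ≤ b.formBilin q φ φ) := by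
    intro C hC
    simp only [WeightedGraph.green_self_le_iff hq hR hP _ hC.le, inv_mul_le_iff₀ hC]
    exact forall_comm
  rw [WeightedGraph.uniformlySubcritical_iff]
  refine ⟨?_, ?_⟩
  · tfae_have 1 ↔ 2 := by
      refine exists_congr fun C => and_congr_right fun hC => ?_
      have h := WeightedGraph.bound_iff_supNorm (C := C) (F := fun φ : X →₀ ℝ => b.form q φ φ)
      simp only [hC.le, and_true] at h
      rw [h]
      simp only [WeightedGraph.form_eq_formBilin]
    tfae_have 1 → 7 := by
      rintro ⟨C, hC, h⟩
      exact ⟨WeightedGraph.subcritical_of_bound hC fun φ => h φ o,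
        WeightedGraph.extendedSpace_subset_C0 hq hC h o⟩
    tfae_have 7 → 3 := fun ⟨h1, h2⟩ =>
      ⟨h1, WeightedGraph.exists_bound_of_extendedSpace_subset hq hb o h2⟩
    tfae_have 3 → 1 := by
      rintro ⟨h1, C, hC, h2⟩
      obtain ⟨c, hc, h3⟩ := h1.exists_bound_at hq hb o
      have h4 := (WeightedGraph.bound_iff_supNorm (C := C)).1 ⟨h2, hC.le⟩
      -- Subcriticality at o absorbs φ(o)² into h(φ)/c, so the squared norm is at most (1 + 1/c)
      -- h(φ).
      refine ⟨C / (1 + c⁻¹), by positivity, fun φ x => ?_⟩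
      have h5 := h4.1 φ x
      rw [hq.normAt_sq] at h5
      have h6 := h3 φ
      rw [← le_inv_mul_iff₀ hc] at h6
      rw [div_mul_eq_mul_div, div_le_iff₀ (by positivity)]
      linarith
    tfae_have 1 ↔ 8 := hq.exists_lt_iInf_cap_iff.symm
    tfae_have 1 → 4 := by
      rintro ⟨C, hC, h⟩
      refine ⟨C⁻¹, inv_pos.2 hC, (hgreen _ (inv_pos.2 hC)).2 ?_⟩
      rwa [inv_inv]
    tfae_have 4 → 1 := by
      rintro ⟨C, hC, h⟩
      exact ⟨C⁻¹, inv_pos.2 hC, (hgreen C hC).1 h⟩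
    tfae_have 1 → 6 := by
      rintro ⟨C, hC, h⟩
      refine ⟨2 / C, by positivity, fun x => ?_⟩
      obtain ⟨u, hu0, huC, hud, hu⟩ := WeightedGraph.exists_fundamental_solution hq hC h x
      refine ⟨u, ⟨hu0, fun h0 => ?_, hud, fun y => ?_⟩, huC, fun y => (hu y).ge⟩
      · have h1 := hu x
        rw [h0, (WeightedGraph.schrodinger_eq (h0 ▸ hud) x).2] at h1
        simp at h1
      · rw [hu y]
        exact Finsupp.single_nonneg.2 zero_le_one y
    tfae_have 6 → 5 := fun ⟨C, hC, h⟩ =>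
      ⟨C, hC, fun x => (h x).imp fun u hu => ⟨hu.1, hu.2.1 x, hu.2.2⟩⟩
    tfae_have 5 → 1 := by
      rintro ⟨C, hC, h⟩
      refine ⟨C⁻¹, inv_pos.2 hC, fun φ x => ?_⟩
      obtain ⟨u, hu, hux, hs⟩ := h x
      refine hu.mul_sq_le hb hux ?_ φ
      simpa using hs x
    tfae_finish
  · rintro ⟨C, hC, h⟩
    refine WeightedGraph.green_mem_C0 hq hR hP (inv_pos.2 hC)
      ((hgreen _ (inv_pos.2 hC)).2 ?_)
    rwa [inv_inv]
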